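/- **Setting.** Let $d\ge 2$. Let $V_d\cong\mathbb{C}^{2d+2}$ be the space of pairs $(P,Q)$ of homogeneous polynomials of degree $d$ in $\mathbb{C}[z,w]$, and let $\overline{\mathrm{Rat}}_d=\mathbb{P}(V_d)\cong\mathbb{P}^{2d+1}$. For $f=(P:Q)\in\overline{\mathrm{Rat}}_d$ put $H_f=\gcd(P,Q)$ and let $\phi_f=(P/H_f:Q/H_f):\mathbb{P}^1\to\mathbb{P}^1$ be the induced holomorphic map, of degree $\deg\phi_f=d-\deg H_f\le d$. The zeros of $H_f$ in $\mathbb{P}^1$ are the *holes* of $f$, and the *depth* of a hole is its multiplicity as a zero of $H_f$. The indeterminacy locus $I(d)\subset\overline{\mathrm{Rat}}_d$ is the set of all $f$ such that $\phi_f$ is constant and its constant value is a hole of $f$. For $f\notin I(d)$ and $n\ge 1$, the iterate $f^n\in\overline{\mathrm{Rat}}_{d^n}$ is the point represented by the $n$-fold composition of the polynomial map $(P,Q):\mathbb{C}^2\to\mathbb{C}^2$ with itself. The group $\mathrm{SL}_2(\mathbb{C})$ acts linearly on $V_d$ by conjugation, $A\cdot F=A\circ F\circ A^{-1}$. A point of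 $\overline{\mathrm{Rat}}_d$ is (GIT-)*stable* if the $\mathrm{SL}_2(\mathbb{C})$-orbit in $V_d$ of a lift $F\in V_d\setminus\{0\}$ of it is closed and the stabilizer of $F$ is finite. A probability measure $\mu_f$ on $\mathbb{P}^1$ is attached to $f\in\overline{\mathrm{Rat}}_d\setminus I(d)$ as follows. * If $\deg\phi_f=d$, so that $f=\phi_f$ is a rational map of degree $d$, then $\mu_f$ is its measure of maximal entropy, that is, the unique Borel probability measure with $\phi_f^*\mu_f=d\cdot\mu_f$ that gives no mass to exceptional points (points with finite backward orbit). Here $(\phi^*\mu)(E)=\int \#\{z\in E:\phi(z)=h\}\,d\mu(h)$, solutions being counted with multiplicity. * If $0<\deg\phi_f<d$, then $$\mu_f=\sum_{n=0}^\infty\frac1{d^{n+1}}\sum_{H_f(h)=0}\ \sum_{\phi_f^n(z)=h}\delta_z,$$ where holes $h$ and solutions $z$ are counted with multiplicity. * If $\deg\phi_f=0$, then $\mu_f=\frac1d\sum_{H_f(h)=0}\delta_h$, where holes are counted with multiplicity. **Proposition.** Suppose that $d\ge2$ is even and $f\in\overline{\mathrm{Rat}}_d$, $f\notin I(d)$.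 Then $f^n\in\overline{\mathrm{Rat}}_{d^n}$ is stable for all $n\ge 1$ if and only if $\mu_f(\{z\})\le 1/2$ for all $z\in\mathbb{P}^1$. -/

import Mathlib

open MvPolynomial MeasureTheory
open scoped LinearAlgebra.Projectivization ENNReal

namespace RatBar

noncomputable section

/-- The complex projective line, with homogeneous coordinates `(z : w) = (v 0 : v 1)`. -/
abbrev P1 : Type := ℙ ℂ (Fin 2 → ℂ)

/-- The quotient topology on the projective line. -/
instance instTopologicalSpaceP1 : TopologicalSpace P1 :=
  TopologicalSpace.coinduced (Projectivization.mk' ℂ) inferInstance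

/-- The Borel sigma-algebra of the projective line. -/
instance instMeasurableSpaceP1 : MeasurableSpace P1 := borel P1

/-- Pairs `(P, Q)` of polynomials in two variables `z = X 0`, `w = X 1`, with `P = F 0` and
`Q = F 1`. The nonzero pairs whose two entries are homogeneous of degree `d`, taken up to scale,
are the points `(P : Q)` of the projective space of degenerate rational maps of degree `d`. -/
abbrev FormPair : Type := Fin 2 → MvPolynomial (Fin 2) ℂ

/-- The composition `F ∘ G`, that is `(P_F(P_G, Q_G), Q_F(P_G, Q_G))`. -/
def comp (F G : FormPair) : FormPair := fun i => bind₁ G (F i)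

/-- The `n`-th iterate of a pair under composition; if `F` is homogeneous of degree `d`, it is
homogeneous of degree `d ^ n`. -/
def iter (F : FormPair) : ℕ → FormPair
  | 0 => X
  | n + 1 => comp F (iter F n)

/-- The linear map of a `2 × 2` matrix, as a pair of linear forms. -/
def linearPair (A : Matrix (Fin 2) (Fin 2) ℂ) : FormPair :=
  fun i => ∑ j, C (A i j) * X j

/-! ### Holes, depth, the reduced map -/

attribute [local instance] UniqueFactorizationMonoid.toGCDMonoid

/-- `H_F = gcd (P, Q)`, determined up to a nonzero constant. -/
def gcdForm (F : FormPair) : MvPolynomial (Fin 2) ℂ := gcd (F 0) (F 1)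

theorem gcdForm_dvd (F : FormPair) (i : Fin 2) : gcdForm F ∣ F i := by
  fin_cases i
  · exact gcd_dvd_left _ _
  · exact gcd_dvd_right _ _

/-- The coprime pair `(P / H, Q / H)` with `H = gcd (P, Q)`, a homogeneous lift of `φ_F`. -/
def reduced (F : FormPair) : FormPair := fun i => (gcdForm_dvd F i).choose

theorem eq_gcdForm_mul_reduced (F : FormPair) (i : Fin 2) :
    F i = gcdForm F * reduced F i := (gcdForm_dvd F i).choose_spec

/-- The degree of the holomorphic map `φ_F = (P / H : Q / H)`. -/
def phiDeg (F : FormPair) : ℕ :=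
  max (reduced F 0).totalDegree (reduced F 1).totalDegree

open Classical in
/-- The self-map of the projective line given by a pair of forms of equal degree without common
zero (the identity is used as a filler at common zeros). -/
def toMap (G : FormPair) (z : P1) : P1 :=
  if h : (fun i => eval z.rep (G i)) ≠ 0 then Projectivization.mk ℂ _ h else z

/-- The holomorphic map `φ_F : P1 → P1`. -/
def phi (F : FormPair) : P1 → P1 := toMap (reduced F)

/-- The linear form `b z - a w`, whose only zero is the point `h = (a : b)`. -/
def pointForm (h : P1) : MvPolynomial (Fin 2) ℂ :=
  C (h.rep 1) * X 0 - C (h.rep 0) * X 1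

/-- The multiplicity of `h` as a zero of the gcd `H_F`: the depth of `h` as a hole of `F`. -/
def depth (F : FormPair) (h : P1) : ℕ := multiplicity (pointForm h) (gcdForm F)

/-- A hole is a zero of `H_F`. -/
def IsHole (F : FormPair) (h : P1) : Prop := eval h.rep (gcdForm F) = 0

/-- The indeterminacy locus: `φ_F` has degree `0` and its constant value is a hole. -/
def InIndeterminacyLocus (F : FormPair) : Prop :=
  phiDeg F = 0 ∧ ∃ h : P1, IsHole F h ∧ ∀ z, phi F z = h

/-! ### The measure -/

/-- For a coprime pair `G = (p, q)` of forms of equal degree defining a nonconstant map: the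
multiplicity of `z` as a solution of `G(z) = h`, with `h = (a : b)`, that is, the order of
vanishing at `z` of the form `b p - a q`. It is `0` when `G(z) ≠ h`. -/
def solMult (G : FormPair) (z h : P1) : ℕ :=
  multiplicity (pointForm z) (C (h.rep 1) * G 0 - C (h.rep 0) * G 1)

/-- The triple sum `∑ₙ d^{-(n+1)} ∑_{H(h) = 0} ∑_{φⁿ(z) = h} δ_z`, holes `h` and solutions `z`
being counted with multiplicity. -/
def atomicMeasure (d : ℕ) (F : FormPair) : Measure P1 :=
  Measure.sum fun n : ℕ => Measure.sum fun h : P1 => Measure.sum fun z : P1 =>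
    (((d : ℝ≥0∞) ^ (n + 1))⁻¹ * (depth F h : ℝ≥0∞) * (solMult (iter (reduced F) n) z h : ℝ≥0∞)) •
      Measure.dirac z

/-- The measure `(1/d) ∑_{H(h) = 0} δ_h`, holes being counted with multiplicity. -/
def holeMeasure (d : ℕ) (F : FormPair) : Measure P1 :=
  Measure.sum fun h : P1 => ((d : ℝ≥0∞)⁻¹ * (depth F h : ℝ≥0∞)) • Measure.dirac h

/-- The exceptional points of a rational map `φ_F` of degree at least two: those with finite
backward orbit. -/
def IsExceptional (F : FormPair) (h : P1) : Prop :=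
  {z : P1 | ∃ n : ℕ, (phi F)^[n] z = h}.Finite

/-- The defining property of the measure of maximal entropy of a rational map of degree `d`:
it is the non-exceptional probability measure `μ` with `φ^* μ = d μ`, where the pull-back is
`(φ^* μ)(E) = ∫ #{z ∈ E : φ(z) = h} dμ(h)`, solutions being counted with multiplicity. -/
structure IsMaximalMeasure (d : ℕ) (F : FormPair) (μ : Measure P1) : Prop where
  isProbabilityMeasure : IsProbabilityMeasure μ
  pullback : ∀ E : Set P1, MeasurableSet E →
    ∫⁻ h, (∑' z : E, (solMult (reduced F) z h : ℝ≥0∞)) ∂μ = (d : ℝ≥0∞) * μ E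
  nonexceptional : ∀ h : P1, IsExceptional F h → μ {h} = 0

/-- `μ` is the measure `μ_F` of a point `F` of degree `d`: the measure of maximal entropy if `F`
is a rational map of degree `d`, the triple sum if `0 < deg φ_F < d`, and the normalized counting
measure of the holes if `deg φ_F = 0`. -/
def IsMeasureOf (d : ℕ) (F : FormPair) (μ : Measure P1) : Prop :=
  if phiDeg F = d then IsMaximalMeasure d F μ
  else if 0 < phiDeg F then μ = atomicMeasure d F
  else μ = holeMeasure d F

/-! ### GIT stability for the conjugation action -/

/-- The conjugation action `A · F = A ∘ F ∘ A⁻¹` of `SL₂(ℂ)` on pairs of forms. -/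
def conj (A : Matrix.SpecialLinearGroup (Fin 2) ℂ) (F : FormPair) : FormPair :=
  comp (linearPair (A : Matrix (Fin 2) (Fin 2) ℂ))
    (comp F (linearPair ((A⁻¹ : Matrix.SpecialLinearGroup (Fin 2) ℂ) : Matrix (Fin 2) (Fin 2) ℂ)))

/-- The coordinates in `ℂ^{2d+2}` of a pair of forms of degree `d`: the coefficients
`a_k`, `b_k` of `z^{d-k} w^k` in `P`, `Q`. -/
def coeffs (d : ℕ) (F : FormPair) : Fin 2 → Fin (d + 1) → ℂ :=
  fun i k => coeff (Finsupp.single 0 (d - (k : ℕ)) + Finsupp.single 1 (k : ℕ)) (F i)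

/-- GIT stability of the point `(P : Q)` represented by a nonzero pair of forms of degree `d`,
for the conjugation action of `SL₂(ℂ)`: in the vector space `ℂ^{2d+2}` of such pairs, the orbit
of the lift `(P, Q)` is closed, and the stabilizer of the lift is finite. -/
def IsGITStable (d : ℕ) (F : FormPair) : Prop :=
  F ≠ 0 ∧
  IsClosed (Set.range fun A : Matrix.SpecialLinearGroup (Fin 2) ℂ => coeffs d (conj A F)) ∧
  {A : Matrix.SpecialLinearGroup (Fin 2) ℂ | conj A F = F}.Finite

end

end RatBar

namespace RatBar

open Filter Topology

attribute [local instance] UniqueFactorizationMonoid.toGCDMonoid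

/-! ### Homogeneous polynomials -/

/-! Write `F = H * G` with `H` the gcd and `G` the reduced pair. Homogeneity gives `F^n = H_n *
G^n`, where `H_0 = 1` and `H_{n+1} = H_n^d * (H ∘ G^n)`. Hence the order of `H_n` at `z`, divided by
`d^n`, is the `n`-th partial sum of `∑ d^{-(j+1)} ord_z (H ∘ G^j)`. If `deg φ < d` this series is
the mass `μ {z}` (`atomicMeasure_singleton`, `holeMeasure_singleton`); if `deg φ = d` all its terms
vanish, and the measure of maximal entropy has no atoms (`IsMaximalMeasure.measure_singleton`). So
masses at most `1/2` mean exactly that every `H_n` vanishes to order at most `d^n / 2` at every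
point (`tsum_le_half_iff`).

It remains to compare these depth bounds with stability (`forall_isGITStable_iter_iff`). A stable
pair of even degree `D` satisfies the bound, since a deeper hole lets a diagonal torus contract the
orbit to `0` (`IsGITStable.two_mul_le`). Conversely, in even degree all torus weights are odd, hence
nonzero, and the Hilbert-Mumford argument, proved here by compactness, shows that a pair that is not
stable is destabilized by a torus (`isGITStable_of_not_isDestabilized`). Such a pair may have depth
exactly `D / 2` at the bad point, but it then fixes that point to extra order, and its second
iterate has depth above half of its degree (`IsDestabilized.exists_pow_dvd`). As the second iterate
of `F^n` is `F^{2n}`, the depth bounds for all iterates exclude this. -/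

theorem aeval_mul_of_isHomogeneous {σ R S : Type*} [CommSemiring R] [CommSemiring S] [Algebra R S]
    {p : MvPolynomial σ R} {n : ℕ} (hp : p.IsHomogeneous n) (c : S) (g : σ → S) :
    aeval (fun i => c * g i) p = c ^ n * aeval g p := by
  rw [aeval_def, aeval_def, eval₂_eq, eval₂_eq, Finset.mul_sum]
  refine Finset.sum_congr rfl fun m hm => ?_
  have hdeg : ∑ i ∈ m.support, m i = n := by
    have := hp.degree_eq_sum_deg_support hm
    exact this.symm
  rw [← hdeg, ← Finset.prod_pow_eq_pow_sum, mul_left_comm, ← Finset.prod_mul_distrib]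
  simp only [mul_pow]

theorem eval_smul_of_isHomogeneous {p : MvPolynomial (Fin 2) ℂ} {n : ℕ} (hp : p.IsHomogeneous n)
    (c : ℂ) (v : Fin 2 → ℂ) : eval (c • v) p = c ^ n * eval v p := by
  exact aeval_mul_of_isHomogeneous hp c v

/-- The substitution `X i ↦ T * X i`, whose coefficients are the homogeneous components. -/
noncomputable def gradingHom (σ R : Type*) [CommSemiring R] :
    MvPolynomial σ R →ₐ[R] Polynomial (MvPolynomial σ R) :=
  aeval fun i => Polynomial.X * Polynomial.C (X i)

theorem gradingHom_monomial {σ R : Type*} [CommSemiring R] (m : σ →₀ ℕ) (r : R) :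
    gradingHom σ R (monomial m r) =
      Polynomial.C (monomial m r) * Polynomial.X ^ m.degree := by
  have h := aeval_mul_of_isHomogeneous (S := Polynomial (MvPolynomial σ R))
    (isHomogeneous_monomial (R := R) r (rfl : m.degree = m.degree)) Polynomial.X
    (fun i => Polynomial.C (X i))
  rw [gradingHom, h, mul_comm]
  congr 1
  have : (aeval fun i => Polynomial.C (X i : MvPolynomial σ R)) =
      (Polynomial.CAlgHom : MvPolynomial σ R →ₐ[MvPolynomial σ R] _).restrictScalars R := by
    ext i
    simp
  rw [this]
  rfl

theorem coeff_gradingHom {σ R : Type*} [CommSemiring R] (p : MvPolynomial σ R) (j : ℕ) :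
    (gradingHom σ R p).coeff j = homogeneousComponent j p := by
  induction p using MvPolynomial.induction_on' with
  | monomial m r =>
    rw [gradingHom_monomial, Polynomial.coeff_C_mul_X_pow]
    split_ifs with h
    · rw [h, homogeneousComponent_eq_self (isHomogeneous_monomial r rfl)]
    · rw [homogeneousComponent_of_mem (n := m.degree) (isHomogeneous_monomial r rfl), if_neg h]
  | add p q hp hq => rw [map_add, Polynomial.coeff_add, hp, hq, map_add]

theorem gradingHom_of_isHomogeneous {σ R : Type*} [CommSemiring R] {p : MvPolynomial σ R} {n : ℕ}
    (hp : p.IsHomogeneous n) : gradingHom σ R p = Polynomial.monomial n p := by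
  ext1 j
  rw [coeff_gradingHom, Polynomial.coeff_monomial, homogeneousComponent_of_mem hp]
  simp only [eq_comm]

theorem gradingHom_injective (σ R : Type*) [CommSemiring R] :
    Function.Injective (gradingHom σ R) := by
  intro p q h
  have hev : (Polynomial.evalRingHom (1 : MvPolynomial σ R)).comp (gradingHom σ R).toRingHom =
      RingHom.id _ := by
    ext i <;> simp [gradingHom]
  have := congrArg (Polynomial.evalRingHom (1 : MvPolynomial σ R)) h
  have e (p) : Polynomial.evalRingHom (1 : MvPolynomial σ R) (gradingHom σ R p) = p :=
    RingHom.congr_fun hev p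
  rwa [e, e] at this

/-- A left factor of a nonzero homogeneous polynomial over a domain is homogeneous. -/
theorem exists_isHomogeneous_of_mul {σ R : Type*} [CommRing R] [IsDomain R]
    {p q : MvPolynomial σ R} {n : ℕ} (h : (p * q).IsHomogeneous n) (h0 : p * q ≠ 0) :
    ∃ k, p.IsHomogeneous k := by
  have hp : p ≠ 0 := left_ne_zero_of_mul h0
  have hq : q ≠ 0 := right_ne_zero_of_mul h0
  have hp' : gradingHom σ R p ≠ 0 := fun h => hp (gradingHom_injective σ R (by simpa using h))
  have hq' : gradingHom σ R q ≠ 0 := fun h => hq (gradingHom_injective σ R (by simpa using h))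
  have hmul := gradingHom_of_isHomogeneous h
  rw [map_mul] at hmul
  -- Degree and trailing degree in `T` are both additive over a domain. They agree on the product, a
  -- monomial in `T`, hence on each factor: `p` has a single homogeneous component.
  have h1 := congrArg Polynomial.natDegree hmul
  have h2 := congrArg Polynomial.natTrailingDegree hmul
  rw [Polynomial.natDegree_mul hp' hq', Polynomial.natDegree_monomial_eq n h0] at h1
  rw [Polynomial.natTrailingDegree_mul hp' hq', Polynomial.natTrailingDegree_monomial h0] at h2
  have h3 := Polynomial.natTrailingDegree_le_natDegree (gradingHom σ R p)
  have h4 := Polynomial.natTrailingDegree_le_natDegree (gradingHom σ R q)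
  refine ⟨(gradingHom σ R p).natDegree, ?_⟩
  suffices p = homogeneousComponent (gradingHom σ R p).natDegree p by
    rw [this]
    conv_rhs => rw [← this]
    exact homogeneousComponent_isHomogeneous _ _
  apply gradingHom_injective σ R
  rw [gradingHom_of_isHomogeneous (homogeneousComponent_isHomogeneous _ _)]
  ext1 j
  rw [Polynomial.coeff_monomial, ← coeff_gradingHom p (gradingHom σ R p).natDegree]
  split_ifs with hj
  · rw [hj]
  · rcases lt_or_gt_of_ne hj with hj | hj
    · exact Polynomial.coeff_eq_zero_of_natDegree_lt hj
    · exact Polynomial.coeff_eq_zero_of_lt_natTrailingDegree (by omega)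

/-! ### Composition and iteration -/

/-- The value of a pair at a vector. -/
noncomputable def evalPair (F : FormPair) (v : Fin 2 → ℂ) : Fin 2 → ℂ := fun i => eval v (F i)

theorem evalPair_apply (F : FormPair) (v : Fin 2 → ℂ) (i : Fin 2) :
    evalPair F v i = eval v (F i) := rfl

theorem evalPair_injective : Function.Injective evalPair := fun F G h => by
  funext i
  exact MvPolynomial.funext fun v => congrFun (congrFun h v) i

theorem eval_bind₁ (G : FormPair) (p : MvPolynomial (Fin 2) ℂ) (v : Fin 2 → ℂ) :
    eval v (bind₁ G p) = eval (evalPair G v) p := by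
  induction p using MvPolynomial.induction_on with
  | C a => simp
  | add p q hp hq => rw [map_add, map_add, map_add, hp, hq]
  | mul_X p i hp => rw [map_mul, map_mul, map_mul, hp, bind₁_X_right, eval_X, evalPair_apply]

theorem evalPair_comp (F G : FormPair) (v : Fin 2 → ℂ) :
    evalPair (comp F G) v = evalPair F (evalPair G v) := by
  funext i
  exact eval_bind₁ G (F i) v

theorem evalPair_X (v : Fin 2 → ℂ) : evalPair X v = v := by
  funext i
  simp [evalPair]

theorem evalPair_iter (F : FormPair) (n : ℕ) (v : Fin 2 → ℂ) :
    evalPair (iter F n) v = (evalPair F)^[n] v := by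
  induction n with
  | zero => exact evalPair_X v
  | succ n ih => rw [iter, evalPair_comp, ih, Function.iterate_succ_apply']

theorem iter_add (F : FormPair) (m n : ℕ) : iter F (m + n) = comp (iter F m) (iter F n) := by
  apply evalPair_injective
  funext v
  rw [evalPair_comp, evalPair_iter, evalPair_iter, evalPair_iter, Function.iterate_add_apply]

theorem bind₁_isHomogeneous {p : MvPolynomial (Fin 2) ℂ} {m n : ℕ} (hp : p.IsHomogeneous m)
    {G : FormPair} (hG : ∀ i, (G i).IsHomogeneous n) : (bind₁ G p).IsHomogeneous (n * m) :=
  hp.aeval G hG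

theorem comp_isHomogeneous {F G : FormPair} {m n : ℕ} (hF : ∀ i, (F i).IsHomogeneous m)
    (hG : ∀ i, (G i).IsHomogeneous n) (i : Fin 2) : (comp F G i).IsHomogeneous (n * m) :=
  bind₁_isHomogeneous (hF i) hG

theorem iter_isHomogeneous {F : FormPair} {d : ℕ} (hF : ∀ i, (F i).IsHomogeneous d) (n : ℕ) :
    ∀ i, (iter F n i).IsHomogeneous (d ^ n) := by
  induction n with
  | zero => exact fun i => by simpa [iter] using isHomogeneous_X ℂ i
  | succ n ih => exact comp_isHomogeneous hF ih

theorem bind₁_mul_of_isHomogeneous {p : MvPolynomial (Fin 2) ℂ} {n : ℕ} (hp : p.IsHomogeneous n)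
    (c : MvPolynomial (Fin 2) ℂ) (G : FormPair) :
    bind₁ (fun i => c * G i) p = c ^ n * bind₁ G p :=
  aeval_mul_of_isHomogeneous hp c G

/-! ### Linear forms -/

/-- The linear form `b z - a w` vanishing at the vector `(a, b)`. -/
noncomputable def lineForm (v : Fin 2 → ℂ) : MvPolynomial (Fin 2) ℂ := C (v 1) * X 0 - C (v 0) * X 1

theorem pointForm_eq (h : P1) : pointForm h = lineForm h.rep := rfl

theorem eval_lineForm (u v : Fin 2 → ℂ) : eval v (lineForm u) = u 1 * v 0 - u 0 * v 1 := by
  simp [lineForm]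

theorem bind₁_lineForm (u : Fin 2 → ℂ) (G : FormPair) :
    bind₁ G (lineForm u) = C (u 1) * G 0 - C (u 0) * G 1 := by
  simp [lineForm]

theorem lineForm_smul (c : ℂ) (v : Fin 2 → ℂ) : lineForm (c • v) = C c * lineForm v := by
  simp only [lineForm, Pi.smul_apply, smul_eq_mul, map_mul]
  ring

theorem lineForm_isHomogeneous (v : Fin 2 → ℂ) : (lineForm v).IsHomogeneous 1 :=
  (isHomogeneous_C_mul_X _ _).sub (isHomogeneous_C_mul_X _ _)

theorem eval_lineForm_eq_zero_iff {u v : Fin 2 → ℂ} (hu : u ≠ 0) :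
    eval v (lineForm u) = 0 ↔ ∃ c : ℂ, v = c • u := by
  rw [eval_lineForm]
  constructor
  · intro h
    by_cases h0 : u 0 = 0
    · have h1 : u 1 ≠ 0 := fun h1 => hu (by funext i; fin_cases i <;> assumption)
      refine ⟨v 1 / u 1, ?_⟩
      funext i
      fin_cases i
      · simpa [h0, h1] using h
      · simp [h1]
    · refine ⟨v 0 / u 0, ?_⟩
      funext i
      fin_cases i
      · simp [h0]
      · simp only [Fin.mk_one, Pi.smul_apply, smul_eq_mul]
        field_simp
        linear_combination -h
  · rintro ⟨c, rfl⟩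
    simp only [Pi.smul_apply, smul_eq_mul]
    ring

/-- Restriction to the line spanned by `v`. -/
noncomputable def restrictLine (v : Fin 2 → ℂ) : MvPolynomial (Fin 2) ℂ →ₐ[ℂ] Polynomial ℂ :=
  aeval fun i => Polynomial.X * Polynomial.C (v i)

theorem restrictLine_of_isHomogeneous (v : Fin 2 → ℂ) {p : MvPolynomial (Fin 2) ℂ} {n : ℕ}
    (hp : p.IsHomogeneous n) :
    restrictLine v p = Polynomial.X ^ n * Polynomial.C (eval v p) := by
  rw [restrictLine, aeval_mul_of_isHomogeneous hp]
  congr 1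
  have : (aeval fun i => Polynomial.C (v i)) =
      (Polynomial.CAlgHom : ℂ →ₐ[ℂ] Polynomial ℂ).comp (aeval v) := by
    ext i
    simp
  rw [this, ← aeval_eq_eval]
  rfl

theorem lineForm_dvd_sub_bind₁ {v : Fin 2 → ℂ} {y : FormPair}
    (hy : ∀ i, lineForm v ∣ X i - y i) (q : MvPolynomial (Fin 2) ℂ) :
    lineForm v ∣ q - bind₁ y q := by
  rw [← Ideal.mem_span_singleton, ← Ideal.Quotient.mk_eq_mk_iff_sub_mem]
  have h : (Ideal.Quotient.mkₐ ℂ (Ideal.span {lineForm v})) =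
      (Ideal.Quotient.mkₐ ℂ (Ideal.span {lineForm v})).comp (bind₁ y) := by
    ext i
    simp only [AlgHom.comp_apply, bind₁_X_right, Ideal.Quotient.mkₐ_eq_mk]
    rw [Ideal.Quotient.mk_eq_mk_iff_sub_mem, Ideal.mem_span_singleton]
    exact hy i
  exact AlgHom.congr_fun h q

/-- If `v j ≠ 0`, then `X i ≡ (v i / v j) * X j` modulo the line form, and this substitution factors
through restriction to the line. So the ideal of the line form is the kernel of a map to a domain,
which makes the form prime. -/
theorem lineForm_dvd_iff_restrictLine {v : Fin 2 → ℂ} (hv : v ≠ 0) (q : MvPolynomial (Fin 2) ℂ) :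
    lineForm v ∣ q ↔ restrictLine v q = 0 := by
  constructor
  · rintro ⟨r, rfl⟩
    rw [map_mul, restrictLine_of_isHomogeneous v (lineForm_isHomogeneous v), eval_lineForm]
    simp [mul_comm]
  · intro hq
    obtain ⟨j, hj⟩ := Function.ne_iff.mp hv
    have hj : v j ≠ 0 := hj
    have key : bind₁ (fun i => C (v i / v j) * X j) q = 0 := by
      have h : bind₁ (fun i => C (v i / v j) * X j : FormPair) =
          (Polynomial.aeval (C (v j)⁻¹ * X j : MvPolynomial (Fin 2) ℂ)).comp (restrictLine v) := by
        ext1 i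
        simp [restrictLine, div_eq_mul_inv]
        ring
      rw [h, AlgHom.comp_apply, hq, map_zero]
    rw [← sub_zero q, ← key]
    refine lineForm_dvd_sub_bind₁ (fun i => ?_) q
    have hC : (C (v j) : MvPolynomial (Fin 2) ℂ) * C ((v j)⁻¹) = 1 := by
      rw [← C_mul, mul_inv_cancel₀ hj, C_1]
    have hd (a : ℂ) : (C (a / v j) : MvPolynomial (Fin 2) ℂ) = C a * C ((v j)⁻¹) := by
      rw [div_eq_mul_inv, C_mul]
    rw [hd]
    fin_cases i <;> fin_cases j <;> simp only [Fin.mk_one, Fin.zero_eta] at hC ⊢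
    · exact ⟨0, by linear_combination (-X 0) * hC⟩
    · refine ⟨C ((v 1)⁻¹), ?_⟩
      rw [lineForm]
      linear_combination (-X 0) * hC
    · refine ⟨-C ((v 0)⁻¹), ?_⟩
      rw [lineForm]
      linear_combination (-X 1) * hC
    · exact ⟨0, by linear_combination (-X 1) * hC⟩

theorem lineForm_dvd_iff {v : Fin 2 → ℂ} (hv : v ≠ 0) {p : MvPolynomial (Fin 2) ℂ} {n : ℕ}
    (hp : p.IsHomogeneous n) : lineForm v ∣ p ↔ eval v p = 0 := by
  rw [lineForm_dvd_iff_restrictLine hv, restrictLine_of_isHomogeneous v hp]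
  simp

theorem lineForm_ne_zero {v : Fin 2 → ℂ} (hv : v ≠ 0) : lineForm v ≠ 0 := by
  intro h
  obtain ⟨c, hc⟩ := (eval_lineForm_eq_zero_iff (v := ![1, 0]) hv).mp (by rw [h, map_zero])
  obtain ⟨c', hc'⟩ := (eval_lineForm_eq_zero_iff (v := ![0, 1]) hv).mp (by rw [h, map_zero])
  have h1 := congrFun hc 0
  have h2 := congrFun hc 1
  have h3 := congrFun hc' 0
  have h4 := congrFun hc' 1
  simp only [Matrix.cons_val_zero, Matrix.cons_val_one, Pi.smul_apply, smul_eq_mul] at h1 h2 h3 h4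
  have : (1 : ℂ) * 1 = 0 * 0 := by
    nth_rewrite 1 [h1]; nth_rewrite 1 [h4]; nth_rewrite 1 [h2]; rw [h3]; ring
  norm_num at this

theorem lineForm_prime {v : Fin 2 → ℂ} (hv : v ≠ 0) : Prime (lineForm v) := by
  refine ⟨lineForm_ne_zero hv, fun h => ?_, fun p q h => ?_⟩
  · have := (lineForm_dvd_iff_restrictLine hv 1).mp h.dvd
    simp at this
  · simp only [lineForm_dvd_iff_restrictLine hv, map_mul, mul_eq_zero] at h ⊢
    exact h

theorem pointForm_prime (z : P1) : Prime (pointForm z) := lineForm_prime z.rep_nonzero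

theorem pointForm_dvd_iff (z : P1) {p : MvPolynomial (Fin 2) ℂ} {n : ℕ}
    (hp : p.IsHomogeneous n) : pointForm z ∣ p ↔ eval z.rep p = 0 :=
  lineForm_dvd_iff z.rep_nonzero hp

/-! ### The conjugation action -/

/-- The group acting by conjugation. -/
abbrev SL2 : Type := Matrix.SpecialLinearGroup (Fin 2) ℂ

theorem evalPair_linearPair (A : Matrix (Fin 2) (Fin 2) ℂ) (v : Fin 2 → ℂ) :
    evalPair (linearPair A) v = A.mulVec v := by
  funext i
  simp [evalPair, linearPair, Matrix.mulVec, dotProduct]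

theorem linearPair_isHomogeneous (A : Matrix (Fin 2) (Fin 2) ℂ) (i : Fin 2) :
    (linearPair A i).IsHomogeneous 1 :=
  IsHomogeneous.sum _ _ _ fun _ _ => isHomogeneous_C_mul_X _ _

theorem evalPair_conj (A : SL2) (F : FormPair) (v : Fin 2 → ℂ) :
    evalPair (conj A F) v =
      (A : Matrix (Fin 2) (Fin 2) ℂ).mulVec
        (evalPair F (((A⁻¹ : SL2) : Matrix (Fin 2) (Fin 2) ℂ).mulVec v)) := by
  rw [conj, evalPair_comp, evalPair_comp, evalPair_linearPair, evalPair_linearPair]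

theorem conj_mul (A B : SL2) (F : FormPair) : conj (A * B) F = conj A (conj B F) := by
  apply evalPair_injective
  funext v
  simp only [evalPair_conj, mul_inv_rev, Matrix.SpecialLinearGroup.coe_mul, Matrix.mulVec_mulVec]

theorem conj_one (F : FormPair) : conj 1 F = F := by
  apply evalPair_injective
  funext v
  simp [evalPair_conj]

theorem conj_inv_conj (A : SL2) (F : FormPair) : conj A⁻¹ (conj A F) = F := by
  rw [← conj_mul, inv_mul_cancel, conj_one]

theorem conj_zero (A : SL2) : conj A 0 = 0 := by
  apply evalPair_injective
  funext v
  have h (u : Fin 2 → ℂ) : evalPair 0 u = 0 := by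
    funext i
    simp [evalPair]
  rw [evalPair_conj, h, h, Matrix.mulVec_zero]

theorem conj_ne_zero (A : SL2) {F : FormPair} (hF : F ≠ 0) : conj A F ≠ 0 := fun h =>
  hF (by rw [← conj_inv_conj A F, h, conj_zero])

theorem conj_isHomogeneous (A : SL2) {F : FormPair} {D : ℕ} (hF : ∀ i, (F i).IsHomogeneous D)
    (i : Fin 2) : (conj A F i).IsHomogeneous D := by
  have h := comp_isHomogeneous (linearPair_isHomogeneous A)
    (comp_isHomogeneous hF (linearPair_isHomogeneous (A⁻¹ : SL2))) i
  rwa [one_mul, mul_one] at h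

theorem conj_apply (A : SL2) (F : FormPair) (i : Fin 2) :
    conj A F i = ∑ j, C (A i j) * bind₁ (linearPair ((A⁻¹ : SL2) : Matrix _ _ ℂ)) (F j) := by
  simp [conj, comp, linearPair]

/-! ### Coordinates -/

/-- The exponent of `z^{D-k} w^k`. -/
noncomputable def expo (D k : ℕ) : Fin 2 →₀ ℕ := Finsupp.single 0 (D - k) + Finsupp.single 1 k

theorem expo_zero (D k : ℕ) : expo D k 0 = D - k := by simp [expo]

theorem expo_one (D k : ℕ) : expo D k 1 = k := by simp [expo]

theorem coeffs_apply (D : ℕ) (F : FormPair) (i : Fin 2) (k : Fin (D + 1)) :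
    coeffs D F i k = coeff (expo D k) (F i) := rfl

/-- The pair of forms with given coordinates. -/
noncomputable def ofCoeffs (D : ℕ) (c : Fin 2 → Fin (D + 1) → ℂ) : FormPair :=
  fun i => ∑ k : Fin (D + 1), monomial (expo D k) (c i k)

theorem ofCoeffs_coeffs {D : ℕ} {F : FormPair} (hF : ∀ i, (F i).IsHomogeneous D) :
    ofCoeffs D (coeffs D F) = F := by
  funext i
  ext m
  rw [ofCoeffs, coeff_sum]
  simp only [coeff_monomial, coeffs_apply]
  by_cases hm : m.degree = D
  · have hsum : m 0 + m 1 = D := by rw [← hm, Finsupp.degree_eq_sum, Fin.sum_univ_two]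
    have hk : expo D (m 1) = m := by
      ext j
      fin_cases j
      · simp only [Fin.zero_eta, expo_zero]; omega
      · simp only [Fin.mk_one, expo_one]
    rw [Finset.sum_eq_single (⟨m 1, by omega⟩ : Fin (D + 1))]
    · simp [hk]
    · intro k _ hne
      rw [if_neg]
      intro h
      apply hne
      ext
      rw [← expo_one D k, h]
    · simp
  · rw [(hF i).coeff_eq_zero hm]
    refine Finset.sum_eq_zero fun k _ => if_neg ?_
    rintro rfl
    apply hm
    rw [Finsupp.degree_eq_sum, Fin.sum_univ_two, expo_zero, expo_one]
    omega

theorem coeffs_injOn {D : ℕ} {F G : FormPair} (hF : ∀ i, (F i).IsHomogeneous D)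
    (hG : ∀ i, (G i).IsHomogeneous D) (h : coeffs D F = coeffs D G) : F = G := by
  rw [← ofCoeffs_coeffs hF, h, ofCoeffs_coeffs hG]

theorem eq_zero_of_coeffs_eq_zero {D : ℕ} {F : FormPair} (hF : ∀ i, (F i).IsHomogeneous D)
    (h : coeffs D F = 0) : F = 0 :=
  coeffs_injOn hF (fun _ => isHomogeneous_zero _ _ _) (by rw [h]; funext i k; simp [coeffs])

theorem X_one_pow_dvd_of_coeff {D j : ℕ} {p : MvPolynomial (Fin 2) ℂ} (hp : p.IsHomogeneous D)
    (h : ∀ k, k < j → k ≤ D → coeff (expo D k) p = 0) : X 1 ^ j ∣ p := by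
  have hp' : p = ∑ k : Fin (D + 1), monomial (expo D k) (coeff (expo D k) p) :=
    (congrFun (ofCoeffs_coeffs (F := fun _ => p) fun _ => hp) 0).symm
  rw [hp']
  refine Finset.dvd_sum fun k _ => ?_
  by_cases hk : (k : ℕ) < j
  · rw [h k hk (by omega)]
    simp
  · rw [X_pow_eq_monomial, monomial_dvd_monomial]
    refine ⟨Or.inr fun i => ?_, one_dvd _⟩
    fin_cases i <;> (simp [expo]; try omega)

theorem coeff_eq_zero_of_X_one_pow_dvd {D j k : ℕ} {p : MvPolynomial (Fin 2) ℂ}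
    (h : X 1 ^ j ∣ p) (hk : k < j) : coeff (expo D k) p = 0 := by
  obtain ⟨q, rfl⟩ := h
  rw [mul_comm, X_pow_eq_monomial, coeff_mul_monomial', if_neg]
  intro hle
  have := hle 1
  simp [expo] at this
  omega

/-! ### Continuity of the action -/

/-- A family of polynomials whose coefficients depend continuously on the parameter. -/
def ContinuousFamily {T : Type*} [TopologicalSpace T] (f : T → MvPolynomial (Fin 2) ℂ) : Prop :=
  ∀ m, Continuous fun t => coeff m (f t)

namespace ContinuousFamily

variable {T : Type*} [TopologicalSpace T] {f g : T → MvPolynomial (Fin 2) ℂ}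

theorem const (p : MvPolynomial (Fin 2) ℂ) : ContinuousFamily fun _ : T => p :=
  fun _ => continuous_const

theorem monomial {c : T → ℂ} (hc : Continuous c) (m : Fin 2 →₀ ℕ) :
    ContinuousFamily fun t => MvPolynomial.monomial m (c t) := fun m' => by
  simp only [coeff_monomial]
  split_ifs
  · exact hc
  · exact continuous_const

theorem mul (hf : ContinuousFamily f) (hg : ContinuousFamily g) :
    ContinuousFamily fun t => f t * g t := fun m => by
  simp only [coeff_mul]
  exact continuous_finsetSum _ fun x _ => (hf _).mul (hg _)

theorem sum {ι : Type*} (s : Finset ι) {f : ι → T → MvPolynomial (Fin 2) ℂ}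
    (hf : ∀ i, ContinuousFamily (f i)) : ContinuousFamily fun t => ∑ i ∈ s, f i t := fun m => by
  simp only [coeff_sum]
  exact continuous_finsetSum _ fun i _ => hf i m

theorem pow (hf : ContinuousFamily f) (n : ℕ) : ContinuousFamily fun t => f t ^ n := by
  induction n with
  | zero => simpa using const 1
  | succ n ih => simpa only [pow_succ] using ih.mul hf

theorem C_mul {c : T → ℂ} (hc : Continuous c) (hf : ContinuousFamily f) :
    ContinuousFamily fun t => C (c t) * f t := (monomial hc 0).mul hf

theorem bind₁_monomial {G : T → FormPair} (hG : ∀ i, ContinuousFamily fun t => G t i)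
    {c : T → ℂ} (hc : Continuous c) (m : Fin 2 →₀ ℕ) :
    ContinuousFamily fun t => bind₁ (G t) (MvPolynomial.monomial m (c t)) := by
  have h (t : T) : bind₁ (G t) (MvPolynomial.monomial m (c t)) =
      C (c t) * (G t 0 ^ m 0 * G t 1 ^ m 1) := by
    rw [MvPolynomial.bind₁_monomial]
    congr 1
    rw [Finset.prod_subset (Finset.subset_univ _), Fin.prod_univ_two]
    intro i _ hi
    rw [Finsupp.notMem_support_iff.mp hi, pow_zero]
  simp only [h]
  exact C_mul hc (((hG 0).pow _).mul ((hG 1).pow _))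

end ContinuousFamily

/-- Continuity is joint in the matrix and the pair, so that bounds hold uniformly when both range
over compact sets. -/
theorem continuous_coeffs_conj_ofCoeffs (D : ℕ) :
    Continuous fun x : SL2 × (Fin 2 → Fin (D + 1) → ℂ) =>
      coeffs D (conj x.1 (ofCoeffs D x.2)) := by
  refine continuous_pi fun i => continuous_pi fun k => ?_
  suffices h : ContinuousFamily fun x : SL2 × (Fin 2 → Fin (D + 1) → ℂ) =>
      conj x.1 (ofCoeffs D x.2) i from h _
  have hentry (f : SL2 × (Fin 2 → Fin (D + 1) → ℂ) → SL2) (hf : Continuous f) (i j : Fin 2) :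
      Continuous fun x => f x i j :=
    (continuous_apply j).comp (Matrix.SpecialLinearGroup.continuous_apply f hf i)
  simp only [conj_apply, ofCoeffs, map_sum]
  refine ContinuousFamily.sum _ fun j => ContinuousFamily.C_mul (hentry _ continuous_fst i j) ?_
  refine ContinuousFamily.sum _ fun k => ContinuousFamily.bind₁_monomial (fun l => ?_) ?_ _
  · exact ContinuousFamily.sum _ fun m =>
      ContinuousFamily.C_mul (hentry _ continuous_fst.inv l m) (ContinuousFamily.const _)
  · fun_prop

theorem continuous_coeffs_conj (D : ℕ) {F : FormPair} (hF : ∀ i, (F i).IsHomogeneous D) :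
    Continuous fun A : SL2 => coeffs D (conj A F) := by
  have h := (continuous_coeffs_conj_ofCoeffs D).comp
    (continuous_id.prodMk (continuous_const (y := coeffs D F)))
  simpa [Function.comp_def, ofCoeffs_coeffs hF] using h

/-! ### The diagonal torus -/

/-- The diagonal matrix with entries `u⁻¹`, `u`. -/
noncomputable def diagSL (u : ℂˣ) : SL2 := ⟨!![(u : ℂ)⁻¹, 0; 0, (u : ℂ)], by simp⟩

theorem coe_diagSL (u : ℂˣ) :
    (diagSL u : Matrix (Fin 2) (Fin 2) ℂ) = !![(u : ℂ)⁻¹, 0; 0, (u : ℂ)] := rfl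

theorem diagSL_inv (u : ℂˣ) : (diagSL u)⁻¹ = diagSL u⁻¹ := by
  apply Subtype.ext
  rw [Matrix.SpecialLinearGroup.coe_inv, coe_diagSL, coe_diagSL, Matrix.adjugate_fin_two_of]
  simp

theorem coeff_bind₁_scale (s : Fin 2 → ℂ) (p : MvPolynomial (Fin 2) ℂ) (m : Fin 2 →₀ ℕ) :
    coeff m (bind₁ (fun i => C (s i) * X i) p) = s 0 ^ m 0 * s 1 ^ m 1 * coeff m p := by
  induction p using MvPolynomial.induction_on' with
  | monomial n r =>
    have h : bind₁ (fun i => C (s i) * X i) (monomial n r) =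
        monomial n (s 0 ^ n 0 * s 1 ^ n 1 * r) := by
      rw [bind₁_monomial, monomial_eq (s := n) (a := s 0 ^ n 0 * s 1 ^ n 1 * r), Finsupp.prod,
        Finset.prod_subset (Finset.subset_univ n.support),
        Finset.prod_subset (Finset.subset_univ n.support), Fin.prod_univ_two, Fin.prod_univ_two]
      · simp only [map_mul, map_pow]
        ring
      all_goals
        intro i _ hi
        rw [Finsupp.notMem_support_iff.mp hi, pow_zero]
    rw [h, coeff_monomial, coeff_monomial]
    split_ifs with hnm
    · rw [hnm]
    · rw [mul_zero]
  | add p q hp hq => rw [map_add, coeff_add, hp, hq, coeff_add, mul_add]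

/-- The weight of the diagonal torus on the coordinate `(i, k)`. -/
def weight (D : ℕ) (i : Fin 2) (k : ℕ) : ℤ := (D : ℤ) - 2 * k + (if i = 0 then -1 else 1)

theorem coeffs_conj_diagSL (D : ℕ) (u : ℂˣ) (F : FormPair) (i : Fin 2) (k : Fin (D + 1)) :
    coeffs D (conj (diagSL u) F) i k = (u : ℂ) ^ weight D i k * coeffs D F i k := by
  have hu : (u : ℂ) ≠ 0 := u.ne_zero
  have hlin : linearPair ((diagSL u)⁻¹ : SL2) =
      fun i => C ((![(u : ℂ), (u : ℂ)⁻¹] : Fin 2 → ℂ) i) * X i := by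
    rw [diagSL_inv, coe_diagSL]
    funext i
    fin_cases i <;> simp [linearPair]
  have hk : ((D - (k : ℕ) : ℕ) : ℤ) = (D : ℤ) - k := by
    have := k.2
    omega
  rw [coeffs_apply, coeffs_apply, conj_apply, hlin, coeff_sum, Fin.sum_univ_two]
  simp only [coeff_C_mul, coeff_bind₁_scale, expo_zero, expo_one, Matrix.cons_val_zero,
    Matrix.cons_val_one, weight]
  have hpow : (u : ℂ) ^ (D - (k : ℕ)) * (u : ℂ)⁻¹ ^ (k : ℕ) = (u : ℂ) ^ ((D : ℤ) - 2 * k) := by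
    rw [← zpow_natCast, hk, inv_pow, ← zpow_natCast, ← zpow_neg, ← zpow_add₀ hu]
    congr 1
    ring
  rw [hpow, zpow_add₀ hu]
  fin_cases i
  · simp [coe_diagSL]
    ring
  · simp [coe_diagSL]
    ring

/-! ### The numerical criterion: necessity -/

/-- Transitivity on nonzero vectors: any point can be moved to `(1 : 0)`, which the diagonal torus
fixes. -/
theorem exists_SL2_first_column {v : Fin 2 → ℂ} (hv : v ≠ 0) :
    ∃ B : SL2, B 0 0 = v 0 ∧ B 1 0 = v 1 := by
  by_cases h0 : v 0 = 0
  · have h1 : v 1 ≠ 0 := fun h1 => hv (by funext i; fin_cases i <;> assumption)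
    exact ⟨⟨!![v 0, -(v 1)⁻¹; v 1, 0], by simp [h1]⟩, rfl, rfl⟩
  · exact ⟨⟨!![v 0, 0; v 1, (v 0)⁻¹], by simp [h0]⟩, rfl, rfl⟩

theorem SL2_ext {A B : SL2} (h : (A : Matrix (Fin 2) (Fin 2) ℂ) = B) : A = B := Subtype.ext h

theorem SL2_det (B : SL2) : B 0 0 * B 1 1 - B 0 1 * B 1 0 = 1 := by
  have := B.det_coe
  rwa [Matrix.det_fin_two] at this

theorem norm_zpow_natCast_le (n : ℕ) {e : ℤ} (he : e ≤ -1) :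
    ‖((n : ℂ) + 1) ^ e‖ ≤ 1 / ((n : ℝ) + 1) := by
  have h1 : ‖(n : ℂ) + 1‖ = (n : ℝ) + 1 := by
    rw [← Nat.cast_add_one, Complex.norm_natCast, Nat.cast_add_one]
  rw [norm_zpow, h1, one_div, ← zpow_neg_one]
  exact zpow_le_zpow_right₀ (by linarith [(Nat.cast_nonneg n : (0 : ℝ) ≤ n)]) he

/-- At a stable point of even degree `D` both forms cannot vanish to order more than `D / 2`. -/
theorem IsGITStable.two_mul_le {D : ℕ} (hD : Even D) {F : FormPair}
    (hF : ∀ i, (F i).IsHomogeneous D) (hs : IsGITStable D F) {v : Fin 2 → ℂ} (hv : v ≠ 0) {j : ℕ}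
    (hj : ∀ i, lineForm v ^ j ∣ F i) : 2 * j ≤ D := by
  by_contra! hlt
  obtain ⟨hF0, hclosed, -⟩ := hs
  obtain ⟨B, hB0, hB1⟩ := exists_SL2_first_column hv
  have hline : bind₁ (linearPair (B : Matrix (Fin 2) (Fin 2) ℂ)) (lineForm v) = -X 1 := by
    have hdet : (C (B 0 0) * C (B 1 1) - C (B 0 1) * C (B 1 0) : MvPolynomial (Fin 2) ℂ) = 1 := by
      rw [← C_mul, ← C_mul, ← C_sub, SL2_det, C_1]
    rw [bind₁_lineForm]
    simp only [linearPair, Fin.sum_univ_two, ← hB0, ← hB1]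
    linear_combination (-X 1) * hdet
  have hdvd (i : Fin 2) : X 1 ^ j ∣ conj B⁻¹ F i := by
    rw [conj_apply, inv_inv]
    refine Finset.dvd_sum fun l _ => Dvd.dvd.mul_left ?_ _
    have h := map_dvd (bind₁ (linearPair (B : Matrix (Fin 2) (Fin 2) ℂ))) (hj l)
    rw [map_pow, hline] at h
    exact (Associated.pow_pow (Associated.refl _).neg_left).dvd_iff_dvd_left.mp h
  have hu (n : ℕ) : (n : ℂ) + 1 ≠ 0 := by exact_mod_cast n.succ_ne_zero
  -- With the deep point at `(1 : 0)` only coordinates with `k ≥ j ≥ D / 2 + 1` survive. Their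
  -- weights are at most `-1`, so the torus at `u = n + 1` contracts the pair to `0`.
  have hmem : (0 : Fin 2 → Fin (D + 1) → ℂ) ∈ Set.range fun A : SL2 => coeffs D (conj A F) := by
    refine hclosed.mem_of_tendsto (b := atTop)
      (f := fun n : ℕ => coeffs D (conj (diagSL (Units.mk0 _ (hu n)) * B⁻¹) F)) ?_
      (Eventually.of_forall fun n => ⟨_, rfl⟩)
    refine tendsto_pi_nhds.mpr fun i => tendsto_pi_nhds.mpr fun k => ?_
    simp only [conj_mul, coeffs_conj_diagSL, Units.val_mk0, Pi.zero_apply]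
    by_cases hk : (k : ℕ) < j
    · simp [coeffs_apply, coeff_eq_zero_of_X_one_pow_dvd (hdvd i) hk]
    · rw [← zero_mul (coeffs D (conj B⁻¹ F) i k)]
      refine Tendsto.mul_const _ (squeeze_zero_norm (fun n => norm_zpow_natCast_le n ?_)
        tendsto_one_div_add_atTop_nhds_zero_nat)
      obtain ⟨r, rfl⟩ := hD
      rw [weight]
      split_ifs <;> push_cast <;> omega
  obtain ⟨A, hA⟩ := hmem
  exact conj_ne_zero A hF0 (eq_zero_of_coeffs_eq_zero (conj_isHomogeneous A hF) hA)

/-! ### The numerical criterion: sufficiency -/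

/-- Some one-parameter subgroup has only positive weights on the pair `F` of degree `D`. -/
def IsDestabilized (D : ℕ) (F : FormPair) : Prop :=
  ∃ A : SL2, X 1 ^ (D / 2) ∣ conj A F 0 ∧ X 1 ^ (D / 2 + 1) ∣ conj A F 1

/-- For `D = 2 r` the weight is positive exactly when `k < r` in the first form and when `k ≤ r` in
the second, whence the two exponents of `X 1`. -/
theorem isDestabilized_of_coeffs {D : ℕ} (hD : Even D) {F : FormPair}
    (hF : ∀ i, (F i).IsHomogeneous D) (A : SL2)
    (h : ∀ i k, 0 < weight D i (k : Fin (D + 1)) → coeffs D (conj A F) i k = 0) :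
    IsDestabilized D F := by
  obtain ⟨r, rfl⟩ := hD
  refine ⟨A, X_one_pow_dvd_of_coeff (conj_isHomogeneous A hF 0) fun k hk hkD => ?_,
    X_one_pow_dvd_of_coeff (conj_isHomogeneous A hF 1) fun k hk hkD => ?_⟩
  · refine h 0 ⟨k, by omega⟩ ?_
    simp only [weight, if_true]
    push_cast
    omega
  · refine h 1 ⟨k, by omega⟩ ?_
    simp only [weight, one_ne_zero, if_false]
    push_cast
    omega

/-- The matrices with entries of norm at most `M`. -/
def boundedSL (M : ℝ) : Set SL2 := {A | ∀ i j, ‖A i j‖ ≤ M}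

theorem isCompact_boundedSL (M : ℝ) : IsCompact (boundedSL M) := by
  have h : IsCompact {A : Matrix (Fin 2) (Fin 2) ℂ | ∀ i j, ‖A i j‖ ≤ M} := by
    have : {A : Matrix (Fin 2) (Fin 2) ℂ | ∀ i j, ‖A i j‖ ≤ M} =
        Set.pi Set.univ fun _ => Set.pi Set.univ fun _ => Metric.closedBall (0 : ℂ) M := by
      ext A
      exact ⟨fun h i _ j _ => mem_closedBall_zero_iff.mpr (h i j),
        fun h i j => mem_closedBall_zero_iff.mp (h i trivial j trivial)⟩
    rw [this]
    exact isCompact_univ_pi fun _ => isCompact_univ_pi fun _ => isCompact_closedBall _ _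
  exact Matrix.SpecialLinearGroup.isClosedEmbedding_val.isCompact_preimage h

/-- `A` is the product of a bounded matrix, a diagonal matrix and a bounded matrix, the diagonal
one dominating `A`. -/
def HasPivotDecomposition (A : SL2) (M : ℝ) : Prop :=
  ∃ k ∈ boundedSL 1, ∃ l ∈ boundedSL 1, ∃ u : ℂˣ, A = k * diagSL u * l ∧ M ≤ ‖(u : ℂ)‖

/-- Gaussian elimination with the largest entry as pivot: the multipliers have norm at most `1`, and
determinant one makes the other diagonal entry the inverse of the pivot. -/
theorem hasPivotDecomposition_of_lower_right {A : SL2} (h : ∀ i j, ‖A i j‖ ≤ ‖A 1 1‖) :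
    HasPivotDecomposition A ‖A 1 1‖ := by
  have hdet := SL2_det A
  have hp : A 1 1 ≠ 0 := by
    intro hp
    have h0 (i j) : A i j = 0 := by
      have := h i j
      rw [hp, norm_zero] at this
      exact norm_le_zero_iff.mp this
    rw [h0, h0, h0, h0] at hdet
    norm_num at hdet
  have hdiv (i j) : ‖A i j / A 1 1‖ ≤ 1 := by
    rw [norm_div]
    exact div_le_one_of_le₀ (h i j) (norm_nonneg _)
  refine ⟨⟨!![1, A 0 1 / A 1 1; 0, 1], by simp⟩, ?_, ⟨!![1, 0; A 1 0 / A 1 1, 1], by simp⟩, ?_,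
    Units.mk0 _ hp, ?_, le_rfl⟩
  · intro i j
    have := hdiv 0 1
    rw [norm_div] at this
    fin_cases i <;> fin_cases j <;> simp [this]
  · intro i j
    have := hdiv 1 0
    rw [norm_div] at this
    fin_cases i <;> fin_cases j <;> simp [this]
  · apply SL2_ext
    change (A : Matrix (Fin 2) (Fin 2) ℂ) = !![1, A 0 1 / A 1 1; 0, 1] *
      !![(A 1 1)⁻¹, 0; 0, A 1 1] * !![1, 0; A 1 0 / A 1 1, 1]
    simp only [Matrix.mul_fin_two]
    ext i j
    fin_cases i <;> fin_cases j <;> simp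
    all_goals field_simp
    linear_combination hdet

/-- The Weyl element. -/
def weylSL : SL2 := ⟨!![0, 1; -1, 0], by simp⟩

theorem weylSL_mul (B : SL2) (j : Fin 2) :
    (weylSL * B) 0 j = B 1 j ∧ (weylSL * B) 1 j = -B 0 j := by
  have h : (weylSL : Matrix (Fin 2) (Fin 2) ℂ) = !![0, 1; -1, 0] := rfl
  constructor <;> simp [Matrix.SpecialLinearGroup.coe_mul, h, Matrix.mul_apply]

theorem mul_weylSL (B : SL2) (i : Fin 2) :
    (B * weylSL) i 0 = -B i 1 ∧ (B * weylSL) i 1 = B i 0 := by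
  have h : (weylSL : Matrix (Fin 2) (Fin 2) ℂ) = !![0, 1; -1, 0] := rfl
  constructor <;> simp [Matrix.SpecialLinearGroup.coe_mul, h, Matrix.mul_apply]

theorem weylSL_inv_mul (B : SL2) (j : Fin 2) :
    (weylSL⁻¹ * B) 0 j = -B 1 j ∧ (weylSL⁻¹ * B) 1 j = B 0 j := by
  have h := weylSL_mul (weylSL⁻¹ * B) j
  rw [mul_inv_cancel_left] at h
  rw [h.1, h.2, neg_neg]
  exact ⟨rfl, rfl⟩

theorem mul_weylSL_inv (B : SL2) (i : Fin 2) :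
    (B * weylSL⁻¹) i 0 = B i 1 ∧ (B * weylSL⁻¹) i 1 = -B i 0 := by
  have h := mul_weylSL (B * weylSL⁻¹) i
  rw [inv_mul_cancel_right] at h
  rw [h.1, h.2, neg_neg]
  exact ⟨rfl, rfl⟩

theorem HasPivotDecomposition.of_weyl_mul {A : SL2} {M : ℝ}
    (h : HasPivotDecomposition (weylSL * A) M) : HasPivotDecomposition A M := by
  obtain ⟨k, hk, l, hl, u, hA, hu⟩ := h
  refine ⟨weylSL⁻¹ * k, fun i j => ?_, l, hl, u, ?_, hu⟩
  · have h0 := hk 0 j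
    have h1 := hk 1 j
    fin_cases i <;> simpa only [Fin.mk_one, Fin.zero_eta, weylSL_inv_mul, norm_neg]
  · rw [mul_assoc, mul_assoc, ← mul_assoc k, ← hA, inv_mul_cancel_left]

theorem HasPivotDecomposition.of_mul_weyl {A : SL2} {M : ℝ}
    (h : HasPivotDecomposition (A * weylSL) M) : HasPivotDecomposition A M := by
  obtain ⟨k, hk, l, hl, u, hA, hu⟩ := h
  refine ⟨k, hk, l * weylSL⁻¹, fun i j => ?_, u, ?_, hu⟩
  · have h0 := hl i 0
    have h1 := hl i 1
    fin_cases j <;> simpa only [Fin.mk_one, Fin.zero_eta, mul_weylSL_inv, norm_neg]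
  · rw [← mul_assoc, ← hA, mul_inv_cancel_right]

/-- Weyl elements on either side bring the largest entry to the lower right corner and change other
entries only by place and sign. -/
theorem hasPivotDecomposition_of_max {A : SL2} {i₀ j₀ : Fin 2}
    (h : ∀ i j, ‖A i j‖ ≤ ‖A i₀ j₀‖) : HasPivotDecomposition A ‖A i₀ j₀‖ := by
  have h00 := h 0 0
  have h01 := h 0 1
  have h10 := h 1 0
  have h11 := h 1 1
  fin_cases i₀ <;> fin_cases j₀ <;> simp only [Fin.mk_one, Fin.zero_eta] at *
  · refine HasPivotDecomposition.of_weyl_mul (HasPivotDecomposition.of_mul_weyl ?_)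
    have := hasPivotDecomposition_of_lower_right (A := weylSL * A * weylSL) (fun i j => by
      fin_cases i <;> fin_cases j <;>
        simp only [Fin.mk_one, Fin.zero_eta, mul_weylSL, weylSL_mul, norm_neg] <;> assumption)
    simpa only [mul_weylSL, weylSL_mul, norm_neg] using this
  · refine HasPivotDecomposition.of_weyl_mul ?_
    have := hasPivotDecomposition_of_lower_right (A := weylSL * A) (fun i j => by
      fin_cases i <;> fin_cases j <;>
        simp only [Fin.mk_one, Fin.zero_eta, weylSL_mul, norm_neg] <;> assumption)
    simpa only [mul_weylSL, weylSL_mul, norm_neg] using this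
  · refine HasPivotDecomposition.of_mul_weyl ?_
    have := hasPivotDecomposition_of_lower_right (A := A * weylSL) (fun i j => by
      fin_cases i <;> fin_cases j <;>
        simp only [Fin.mk_one, Fin.zero_eta, mul_weylSL, norm_neg] <;> assumption)
    simpa only [mul_weylSL, weylSL_mul, norm_neg] using this
  · exact hasPivotDecomposition_of_lower_right h

theorem hasPivotDecomposition {A : SL2} {M : ℝ} {i j : Fin 2} (h : M ≤ ‖A i j‖) :
    HasPivotDecomposition A M := by
  obtain ⟨x, hx⟩ := Finite.exists_max fun x : Fin 2 × Fin 2 => ‖A x.1 x.2‖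
  obtain ⟨k, hk, l, hl, u, hA, hu⟩ := hasPivotDecomposition_of_max (A := A) fun i j => hx (i, j)
  exact ⟨k, hk, l, hl, u, hA, (h.trans (hx (i, j))).trans hu⟩

theorem exists_bound_coeffs_conj_inv (D : ℕ) (M R : ℝ) : ∃ K : ℝ, ∀ F : FormPair,
    (∀ i, (F i).IsHomogeneous D) → ‖coeffs D F‖ ≤ R → ∀ k ∈ boundedSL M,
      ‖coeffs D (conj k⁻¹ F)‖ ≤ K := by
  have hcont := (continuous_coeffs_conj_ofCoeffs D).comp
    (Continuous.prodMk (f := fun x : SL2 × (Fin 2 → Fin (D + 1) → ℂ) => x.1⁻¹)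
      (by fun_prop) continuous_snd)
  have hc := ((isCompact_boundedSL M).prod
    (isCompact_closedBall (0 : Fin 2 → Fin (D + 1) → ℂ) R)).image hcont
  obtain ⟨K, hK⟩ := hc.isBounded.exists_norm_le
  refine ⟨K, fun F hF hR k hk => ?_⟩
  have := hK _ ⟨(k, coeffs D F), ⟨hk, by simpa using hR⟩, rfl⟩
  simpa only [Function.comp_apply, ofCoeffs_coeffs hF] using this

instance instFirstCountableTopologySL2 : FirstCountableTopology SL2 :=
  haveI : FirstCountableTopology (Matrix (Fin 2) (Fin 2) ℂ) :=
    inferInstanceAs (FirstCountableTopology (Fin 2 → Fin 2 → ℂ))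
  Matrix.SpecialLinearGroup.isClosedEmbedding_val.isInducing.firstCountableTopology

/-- If no one-parameter subgroup has only positive weights, the orbit map is proper. -/
theorem exists_bound_of_not_isDestabilized {D : ℕ} (hD : Even D) {F : FormPair}
    (hF : ∀ i, (F i).IsHomogeneous D) (hdes : ¬ IsDestabilized D F) (R : ℝ) :
    ∃ M : ℝ, ∀ A : SL2, ‖coeffs D (conj A F)‖ ≤ R → A ∈ boundedSL M := by
  by_contra! hcon
  choose A hA hA' using fun n : ℕ => hcon ((n : ℝ) + 1)
  have hdec (n : ℕ) : HasPivotDecomposition (A n) ((n : ℝ) + 1) := by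
    have h := hA' n
    simp only [boundedSL, Set.mem_ofPred_eq, not_forall, not_le] at h
    obtain ⟨i, j, hij⟩ := h
    exact hasPivotDecomposition hij.le
  choose k hk l hl u hklu hu using hdec
  obtain ⟨K, hK⟩ := exists_bound_coeffs_conj_inv D 1 R
  obtain ⟨B, -, φ, hφ, hlim⟩ := (isCompact_boundedSL 1).tendsto_subseq hl
  refine hdes (isDestabilized_of_coeffs hD hF B fun i m hw => ?_)
  -- Cancelling the bounded factor `k n` leaves the torus acting on `conj (l n) F` with bounded
  -- result. A positive weight multiplies its coordinate by at least `n + 1` in norm, so this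
  -- coordinate tends to `0`, and it vanishes at the limit `B` of the `l n`.
  have hbound (n : ℕ) : ‖coeffs D (conj (l n) F) i m‖ ≤ K * (1 / ((n : ℝ) + 1)) := by
    have h1 := hK _ (conj_isHomogeneous (A n) hF) (hA n) (k n) (hk n)
    rw [← conj_mul, hklu n, mul_assoc, inv_mul_cancel_left, conj_mul] at h1
    have h2 := (norm_le_pi_norm _ m).trans ((norm_le_pi_norm _ i).trans h1)
    rw [coeffs_conj_diagSL, norm_mul, norm_zpow] at h2
    have hn : (0 : ℝ) < (n : ℝ) + 1 := by positivity
    have h3 : (n : ℝ) + 1 ≤ ‖(u n : ℂ)‖ ^ weight D i m := by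
      have hone : 1 ≤ ‖(u n : ℂ)‖ :=
        le_trans (by linarith [(Nat.cast_nonneg n : (0 : ℝ) ≤ n)]) (hu n)
      calc (n : ℝ) + 1 ≤ ‖(u n : ℂ)‖ ^ (1 : ℤ) := by rw [zpow_one]; exact hu n
        _ ≤ _ := zpow_le_zpow_right₀ hone hw
    rw [mul_one_div, le_div_iff₀ hn, mul_comm]
    exact (mul_le_mul_of_nonneg_right h3 (norm_nonneg _)).trans h2
  have hzero : Tendsto (fun n => coeffs D (conj (l n) F) i m) atTop (𝓝 0) :=
    squeeze_zero_norm hbound (by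
      simpa using tendsto_one_div_add_atTop_nhds_zero_nat.const_mul K)
  have hlim' : Tendsto (fun n => coeffs D (conj (l (φ n)) F) i m) atTop
      (𝓝 (coeffs D (conj B F) i m)) :=
    (((continuous_apply m).comp ((continuous_apply i).comp
      (continuous_coeffs_conj D hF))).tendsto B).comp hlim
  exact tendsto_nhds_unique hlim' (hzero.comp hφ.tendsto_atTop)

theorem isClosed_orbit_of_not_isDestabilized {D : ℕ} (hD : Even D) {F : FormPair}
    (hF : ∀ i, (F i).IsHomogeneous D) (hdes : ¬ IsDestabilized D F) :
    IsClosed (Set.range fun A : SL2 => coeffs D (conj A F)) := by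
  refine isClosed_of_closure_subset fun G hG => ?_
  obtain ⟨x, hx, hlim⟩ := mem_closure_iff_seq_limit.mp hG
  choose A hA using hx
  obtain ⟨R, hR⟩ := hlim.norm.bddAbove_range
  obtain ⟨M, hM⟩ := exists_bound_of_not_isDestabilized hD hF hdes R
  have hmem (n : ℕ) : A n ∈ boundedSL M := hM _ ((congrArg norm (hA n)).trans_le (hR ⟨n, rfl⟩))
  obtain ⟨B, -, φ, hφ, hB⟩ := (isCompact_boundedSL M).tendsto_subseq hmem
  refine ⟨B, tendsto_nhds_unique (((continuous_coeffs_conj D hF).tendsto B).comp hB) ?_⟩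
  have := hlim.comp hφ.tendsto_atTop
  refine this.congr fun n => ?_
  exact (hA (φ n)).symm

/-! ### Finiteness of the stabilizer -/

theorem trace_SL2 (A : SL2) : (A : Matrix (Fin 2) (Fin 2) ℂ).trace = A 0 0 + A 1 1 :=
  Matrix.trace_fin_two _

theorem trace_conjugate (g A : SL2) :
    ((g * A * g⁻¹ : SL2) : Matrix (Fin 2) (Fin 2) ℂ).trace =
      (A : Matrix (Fin 2) (Fin 2) ℂ).trace := by
  rw [Matrix.SpecialLinearGroup.coe_mul, Matrix.trace_mul_comm,
    ← Matrix.SpecialLinearGroup.coe_mul]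
  have h : g⁻¹ * (g * A) = A := inv_mul_cancel_left g A
  rw [h]

theorem exists_eigenvector (A : SL2) : ∃ l : ℂ, ∃ v : Fin 2 → ℂ, v ≠ 0 ∧
    (A : Matrix (Fin 2) (Fin 2) ℂ).mulVec v = l • v := by
  obtain ⟨l, hl⟩ := Module.End.exists_eigenvalue (Matrix.toLin' (A : Matrix (Fin 2) (Fin 2) ℂ))
  obtain ⟨v, hv⟩ := hl.exists_hasEigenvector
  exact ⟨l, v, hv.2, by simpa using hv.apply_eq_smul⟩

theorem SL2_inv_apply (g : SL2) : g⁻¹ 0 0 = g 1 1 ∧ g⁻¹ 0 1 = -g 0 1 ∧ g⁻¹ 1 0 = -g 1 0 ∧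
    g⁻¹ 1 1 = g 0 0 := by
  rw [Matrix.SpecialLinearGroup.coe_inv, Matrix.adjugate_fin_two]
  exact ⟨rfl, rfl, rfl, rfl⟩

theorem SL2_mul_apply (g h : SL2) (i j : Fin 2) : (g * h) i j = g i 0 * h 0 j + g i 1 * h 1 j := by
  rw [Matrix.SpecialLinearGroup.coe_mul, Matrix.mul_apply, Fin.sum_univ_two]

theorem exists_conjugate_upper_triangular (A : SL2) :
    ∃ g B : SL2, B 1 0 = 0 ∧ A = g * B * g⁻¹ := by
  obtain ⟨l, v, hv, hlv⟩ := exists_eigenvector A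
  obtain ⟨g, hg0, hg1⟩ := exists_SL2_first_column hv
  refine ⟨g, g⁻¹ * A * g, ?_, by group⟩
  have h0 := congrFun hlv 0
  have h1 := congrFun hlv 1
  simp only [Matrix.mulVec, dotProduct, Fin.sum_univ_two, Pi.smul_apply, smul_eq_mul, ← hg0,
    ← hg1] at h0 h1
  rw [mul_assoc, SL2_mul_apply, SL2_mul_apply, SL2_mul_apply, (SL2_inv_apply g).2.2.1,
    (SL2_inv_apply g).2.2.2, h0, h1]
  ring

/-- Trace different from `2` and `-2` means distinct eigenvalues; after triangularization the
unipotent `U` clears the remaining off-diagonal entry. -/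
theorem exists_conjugate_diagSL {A : SL2}
    (h2 : (A : Matrix (Fin 2) (Fin 2) ℂ).trace ≠ 2)
    (h2' : (A : Matrix (Fin 2) (Fin 2) ℂ).trace ≠ -2) :
    ∃ g : SL2, ∃ u : ℂˣ, A = g * diagSL u * g⁻¹ := by
  obtain ⟨g, B, hB, rfl⟩ := exists_conjugate_upper_triangular A
  rw [trace_conjugate, trace_SL2] at h2 h2'
  have hdet := SL2_det B
  rw [hB, mul_zero, sub_zero] at hdet
  have h1 : B 1 1 ≠ 0 := right_ne_zero_of_mul_eq_one hdet
  have h0 : B 0 0 = (B 1 1)⁻¹ := eq_inv_of_mul_eq_one_left hdet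
  have hne : B 1 1 - B 0 0 ≠ 0 := by
    intro h
    rw [sub_eq_zero] at h
    rw [← h] at hdet h2 h2'
    rcases mul_self_eq_one_iff.mp hdet with h' | h'
    · exact h2 (by rw [h']; norm_num)
    · exact h2' (by rw [h']; norm_num)
  let U : SL2 := ⟨!![1, B 0 1 / (B 1 1 - B 0 0); 0, 1], by simp⟩
  have hU : B * U = U * diagSL (Units.mk0 _ h1) := by
    apply SL2_ext
    change (B : Matrix (Fin 2) (Fin 2) ℂ) * !![1, B 0 1 / (B 1 1 - B 0 0); 0, 1] =
      !![1, B 0 1 / (B 1 1 - B 0 0); 0, 1] * !![(B 1 1)⁻¹, 0; 0, B 1 1]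
    ext i j
    rw [Matrix.mul_apply, Matrix.mul_apply, Fin.sum_univ_two, Fin.sum_univ_two]
    fin_cases i <;> fin_cases j <;> simp [hB, h0]
    rw [← h0]
    field_simp
    ring
  refine ⟨g * U, Units.mk0 _ h1, ?_⟩
  have h : g * U * diagSL (Units.mk0 _ h1) * (g * U)⁻¹ = g * B * U * U⁻¹ * g⁻¹ := by
    rw [mul_assoc g B U, hU]
    group
  rw [h]
  group

/-- `D - 2 k ± 1` is odd for even `D`. Therefore a torus element fixing a nonzero pair is a root of
unity of bounded order. -/
theorem weight_ne_zero {D : ℕ} (hD : Even D) (i : Fin 2) (k : ℕ) : weight D i k ≠ 0 := by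
  obtain ⟨r, rfl⟩ := hD
  rw [weight]
  split_ifs <;> push_cast <;> omega

theorem natAbs_weight_le {D : ℕ} (i : Fin 2) {k : ℕ} (hk : k ≤ D) :
    (weight D i k).natAbs ≤ D + 1 := by
  rw [weight]
  split_ifs <;> omega

theorem pow_factorial_eq_one_of_conj_diagSL {D : ℕ} (hD : Even D) {F : FormPair}
    (hF : ∀ i, (F i).IsHomogeneous D) (hF0 : F ≠ 0) {u : ℂˣ} (hu : conj (diagSL u) F = F) :
    (u : ℂ) ^ (D + 1).factorial = 1 := by
  have hc : coeffs D F ≠ 0 := fun h => hF0 (eq_zero_of_coeffs_eq_zero hF h)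
  obtain ⟨i, hi⟩ := Function.ne_iff.mp hc
  obtain ⟨k, hk⟩ := Function.ne_iff.mp hi
  have h := coeffs_conj_diagSL D u F i k
  rw [hu] at h
  have h1 : (u : ℂ) ^ weight D i k = 1 := mul_right_cancel₀ hk (by rw [← h, one_mul])
  have h2 : (u : ℂ) ^ (weight D i k).natAbs = 1 := by
    rcases Int.natAbs_eq (weight D i k) with he | he
    · rwa [he, zpow_natCast] at h1
    · rw [he, zpow_neg, zpow_natCast, inv_eq_one] at h1
      exact h1
  obtain ⟨m, hm⟩ := Nat.dvd_factorial (Int.natAbs_pos.mpr (weight_ne_zero hD i k))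
    (natAbs_weight_le i (Nat.lt_succ_iff.mp k.2))
  rw [hm, pow_mul, h2, one_pow]

theorem one_add_pow_of_mul_self_eq_zero {R : Type*} [Ring R] [Algebra ℂ R] {N : R}
    (h : N * N = 0) (n : ℕ) : (1 + N) ^ n = 1 + (n : ℂ) • N := by
  induction n with
  | zero => simp
  | succ n ih =>
    rw [pow_succ, ih, add_mul, mul_add, mul_add, smul_mul_assoc, smul_mul_assoc, h]
    simp only [mul_one, one_mul, smul_zero, add_zero]
    push_cast
    rw [add_smul, one_smul]
    abel

/-- By Cayley-Hamilton `(A - 1)^2 = 0`, so `A^n = 1 + n (A - 1)`, which is bounded only for `A = 1`.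
-/
theorem eq_one_of_trace_eq_two {A : SL2} {M : ℝ} (hA : ∀ n : ℕ, A ^ n ∈ boundedSL M)
    (h2 : (A : Matrix (Fin 2) (Fin 2) ℂ).trace = 2) : A = 1 := by
  have hdet := SL2_det A
  rw [trace_SL2] at h2
  have hsq : ((A : Matrix (Fin 2) (Fin 2) ℂ) - 1) * (A - 1) = 0 := by
    ext i j
    rw [Matrix.mul_apply, Fin.sum_univ_two]
    fin_cases i <;> fin_cases j <;> simp
    · linear_combination (A 0 0) * h2 - hdet
    · linear_combination (A 0 1) * h2
    · linear_combination (A 1 0) * h2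
    · linear_combination (A 1 1) * h2 - hdet
  have hpow (n : ℕ) : ((A ^ n : SL2) : Matrix (Fin 2) (Fin 2) ℂ) =
      1 + (n : ℂ) • ((A : Matrix (Fin 2) (Fin 2) ℂ) - 1) := by
    rw [Matrix.SpecialLinearGroup.coe_pow, ← one_add_pow_of_mul_self_eq_zero hsq n]
    congr 1
    abel
  apply SL2_ext
  rw [← sub_eq_zero]
  ext i j
  by_contra hne
  have hpos : 0 < ‖((A : Matrix (Fin 2) (Fin 2) ℂ) - 1) i j‖ := norm_pos_iff.mpr hne
  obtain ⟨n, hn⟩ := exists_nat_gt ((M + 1) / ‖((A : Matrix (Fin 2) (Fin 2) ℂ) - 1) i j‖)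
  rw [div_lt_iff₀ hpos] at hn
  have h := hA n i j
  rw [hpow, Matrix.add_apply, Matrix.smul_apply, smul_eq_mul] at h
  have hone : ‖(1 : Matrix (Fin 2) (Fin 2) ℂ) i j‖ ≤ 1 := by
    rw [Matrix.one_apply]
    split_ifs <;> simp
  have h3 := norm_sub_le ((1 : Matrix (Fin 2) (Fin 2) ℂ) i j +
    (n : ℂ) * ((A : Matrix (Fin 2) (Fin 2) ℂ) - 1) i j) ((1 : Matrix (Fin 2) (Fin 2) ℂ) i j)
  rw [add_sub_cancel_left, norm_mul, Complex.norm_natCast] at h3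
  linarith

theorem finite_trace_set (N : ℕ) (hN : 0 < N) :
    {t : ℂ | ∃ z : ℂ, z ^ N = 1 ∧ t = z⁻¹ + z}.Finite := by
  have h : {z : ℂ | z ^ N = 1}.Finite := by
    refine (Polynomial.nthRootsFinset N (1 : ℂ)).finite_toSet.subset fun z hz => ?_
    exact (Polynomial.mem_nthRootsFinset hN _).mpr hz
  refine (h.image fun z => z⁻¹ + z).subset ?_
  rintro t ⟨z, hz, rfl⟩
  exact ⟨z, hz, rfl⟩

theorem finite_stabilizer_of_bounded {D : ℕ} (hD : Even D) {F : FormPair}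
    (hF : ∀ i, (F i).IsHomogeneous D) (hF0 : F ≠ 0) {M : ℝ}
    (hM : ∀ A : SL2, conj A F = F → A ∈ boundedSL M) :
    {A : SL2 | conj A F = F}.Finite := by
  have hmul {A B : SL2} (hA : conj A F = F) (hB : conj B F = F) : conj (A * B) F = F := by
    rw [conj_mul, hB, hA]
  have hinv {A : SL2} (hA : conj A F = F) : conj A⁻¹ F = F := by
    conv_lhs => rw [← hA]
    exact conj_inv_conj A F
  have hpow {A : SL2} (hA : conj A F = F) (n : ℕ) : conj (A ^ n) F = F := by
    induction n with
    | zero => exact conj_one F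
    | succ n ih => rw [pow_succ]; exact hmul ih hA
  -- A finite set, avoiding `2`, that contains the traces of all nontrivial stabilizer elements. The
  -- value `-2` is added by hand, since the diagonalization does not cover it.
  set T : Set ℂ := insert (-2) ({t : ℂ | ∃ z : ℂ, z ^ (D + 1).factorial = 1 ∧ t = z⁻¹ + z} \ {2})
    with hT
  have hTfin : T.Finite := ((finite_trace_set _ (Nat.factorial_pos _)).subset
    Set.sdiff_subset).insert _
  have htrace {A : SL2} (hA : conj A F = F) (h1 : A ≠ 1) :
      (A : Matrix (Fin 2) (Fin 2) ℂ).trace ∈ T := by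
    have h2 : (A : Matrix (Fin 2) (Fin 2) ℂ).trace ≠ 2 := fun h2 =>
      h1 (eq_one_of_trace_eq_two (fun n => hM _ (hpow hA n)) h2)
    by_cases h2' : (A : Matrix (Fin 2) (Fin 2) ℂ).trace = -2
    · exact Or.inl h2'
    · obtain ⟨g, u, rfl⟩ := exists_conjugate_diagSL h2 h2'
      refine Or.inr ⟨⟨u, ?_, ?_⟩, h2⟩
      · refine pow_factorial_eq_one_of_conj_diagSL hD (conj_isHomogeneous g⁻¹ hF)
          (conj_ne_zero g⁻¹ hF0) ?_
        conv_rhs => rw [← hA]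
        rw [← conj_mul, ← conj_mul]
        congr 1
        group
      · rw [trace_conjugate, trace_SL2, coe_diagSL]
        simp
  -- An infinite bounded stabilizer accumulates at some `x`. Distinct elements `A`, `B` near `x`
  -- give a nontrivial stabilizer element `A⁻¹ * B` of trace near `2`, hence outside `T`.
  by_contra hinf
  obtain ⟨x, -, hx⟩ := Set.Infinite.exists_accPt_of_subset_isCompact hinf (isCompact_boundedSL M)
    fun A hA => hM A hA
  rw [accPt_iff_nhds] at hx
  have hcont : Continuous fun y : SL2 × SL2 =>
      ((y.1⁻¹ * y.2 : SL2) : Matrix (Fin 2) (Fin 2) ℂ).trace :=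
    (continuous_subtype_val.comp ((continuous_fst (X := SL2) (Y := SL2)).inv.mul
      continuous_snd)).matrix_trace
  have hmem : (fun y : SL2 × SL2 =>
      ((y.1⁻¹ * y.2 : SL2) : Matrix (Fin 2) (Fin 2) ℂ).trace) ⁻¹' Tᶜ ∈ 𝓝 (x, x) := by
    refine (hTfin.isClosed.isOpen_compl.preimage hcont).mem_nhds ?_
    have h2 : ((x⁻¹ * x : SL2) : Matrix (Fin 2) (Fin 2) ℂ).trace = 2 := by
      rw [inv_mul_cancel]
      simp
    change _ ∉ T
    dsimp only
    rw [h2]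
    rintro (h | h)
    · norm_num at h
    · exact h.2 rfl
  rw [nhds_prod_eq] at hmem
  obtain ⟨V, hV, hVV⟩ := Filter.mem_prod_same_iff.mp hmem
  obtain ⟨A, ⟨hAV, hA⟩, hAx⟩ := hx V hV
  obtain ⟨B, ⟨⟨hBV, hBA⟩, hB⟩, -⟩ := hx (V ∩ {A}ᶜ)
    (Filter.inter_mem hV (isOpen_compl_singleton.mem_nhds hAx.symm))
  refine hVV (Set.mk_mem_prod hAV hBV) (htrace (hmul (hinv hA) hB) fun h => hBA ?_)
  exact (inv_mul_eq_one.mp h).symm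

theorem isGITStable_of_not_isDestabilized {D : ℕ} (hD : Even D) {F : FormPair}
    (hF : ∀ i, (F i).IsHomogeneous D) (hF0 : F ≠ 0) (hdes : ¬ IsDestabilized D F) :
    IsGITStable D F := by
  obtain ⟨M, hM⟩ := exists_bound_of_not_isDestabilized hD hF hdes ‖coeffs D F‖
  exact ⟨hF0, isClosed_orbit_of_not_isDestabilized hD hF hdes,
    finite_stabilizer_of_bounded hD hF hF0 fun A hA => hM A (by rw [hA])⟩

/-! ### The gcd and the reduced pair of a pair of forms -/

theorem exists_isHomogeneous_eq_mul {p q : MvPolynomial (Fin 2) ℂ} {a b : ℕ}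
    (hp : p.IsHomogeneous (a + b)) (hq : q.IsHomogeneous a) (hq0 : q ≠ 0) (h : q ∣ p) :
    ∃ r : MvPolynomial (Fin 2) ℂ, r.IsHomogeneous b ∧ p = q * r := by
  obtain ⟨r, rfl⟩ := h
  by_cases hr : r = 0
  · exact ⟨0, isHomogeneous_zero _ _ _, by rw [hr]⟩
  · have h0 : q * r ≠ 0 := mul_ne_zero hq0 hr
    obtain ⟨e, he⟩ := exists_isHomogeneous_of_mul (p := r) (q := q) (by rwa [mul_comm r q])
      (by rwa [mul_comm r q])
    have : a + e = a + b := (hq.mul he).inj_right hp h0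
    exact ⟨r, by rwa [← add_left_cancel this], rfl⟩

theorem gcdForm_ne_zero {F : FormPair} (hF0 : F ≠ 0) : gcdForm F ≠ 0 := fun h =>
  hF0 (funext fun i => by rw [eq_gcdForm_mul_reduced F i, h, zero_mul]; rfl)

theorem isUnit_gcd_reduced {F : FormPair} (hF0 : F ≠ 0) :
    IsUnit (gcd (reduced F 0) (reduced F 1)) := by
  have h : Associated (gcdForm F) (gcdForm F * gcd (reduced F 0) (reduced F 1)) := by
    have := gcd_mul_left' (gcdForm F) (reduced F 0) (reduced F 1)
    rwa [← eq_gcdForm_mul_reduced, ← eq_gcdForm_mul_reduced] at this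
  obtain ⟨u, hu⟩ := h
  rw [mul_right_inj' (gcdForm_ne_zero hF0)] at hu
  rw [← hu]
  exact u.isUnit

theorem exists_degrees {d : ℕ} {F : FormPair} (hF : ∀ i, (F i).IsHomogeneous d) (hF0 : F ≠ 0) :
    ∃ k, k + phiDeg F = d ∧ (gcdForm F).IsHomogeneous k ∧
      ∀ i, (reduced F i).IsHomogeneous (phiDeg F) := by
  obtain ⟨i, hi⟩ := Function.ne_iff.mp hF0
  have hi : F i ≠ 0 := hi
  have hmul := eq_gcdForm_mul_reduced F i
  obtain ⟨k, hk⟩ := exists_isHomogeneous_of_mul (p := gcdForm F) (q := reduced F i)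
    (by rw [← hmul]; exact hF i) (by rwa [← hmul])
  have hr0 : reduced F i ≠ 0 := fun h => hi (by rw [hmul, h, mul_zero])
  obtain ⟨e, he⟩ := exists_isHomogeneous_of_mul (p := reduced F i) (q := gcdForm F)
    (by rw [mul_comm, ← hmul]; exact hF i) (by rwa [mul_comm, ← hmul])
  have hke : k + e = d := by
    have h := hk.mul he
    rw [← hmul] at h
    exact h.inj_right (hF i) hi
  have hall (j : Fin 2) : (reduced F j).IsHomogeneous e := by
    obtain ⟨r, hr, hFr⟩ := exists_isHomogeneous_eq_mul (hke ▸ hF j) hk (gcdForm_ne_zero hF0)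
      (gcdForm_dvd F j)
    rw [eq_gcdForm_mul_reduced F j, mul_right_inj' (gcdForm_ne_zero hF0)] at hFr
    rwa [hFr]
  have hdeg : phiDeg F = e := by
    have hie := he.totalDegree hr0
    have h0 := (hall 0).totalDegree_le
    have h1 := (hall 1).totalDegree_le
    rw [phiDeg]
    fin_cases i <;> simp only [Fin.mk_one, Fin.zero_eta] at hie <;> omega
  rw [hdeg]
  exact ⟨k, hke, hk, hall⟩

/-- A pair of forms without common zero on the projective line. -/
def NoCommonZero (G : FormPair) : Prop := ∀ v : Fin 2 → ℂ, v ≠ 0 → evalPair G v ≠ 0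

theorem noCommonZero_reduced {d : ℕ} {F : FormPair} (hF : ∀ i, (F i).IsHomogeneous d)
    (hF0 : F ≠ 0) : NoCommonZero (reduced F) := by
  intro v hv h
  obtain ⟨-, -, -, hG⟩ := exists_degrees hF hF0
  have hdvd (i) : lineForm v ∣ reduced F i := (lineForm_dvd_iff hv (hG i)).mpr (congrFun h i)
  exact (lineForm_prime hv).not_isUnit
    (isUnit_of_dvd_unit (dvd_gcd (hdvd 0) (hdvd 1)) (isUnit_gcd_reduced hF0))

theorem NoCommonZero.iter {G : FormPair} (hG : NoCommonZero G) (n : ℕ) :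
    NoCommonZero (iter G n) := by
  induction n with
  | zero => exact fun v hv => by rwa [RatBar.iter, evalPair_X]
  | succ n ih => exact fun v hv => by rw [RatBar.iter, evalPair_comp]; exact hG _ (ih v hv)

/-- Without zeros, `p (t, 1)` has no root and is a constant `c`. By homogeneity `p (1, s) = c s^m`,
which vanishes at `s = 0`. -/
theorem exists_eval_eq_zero {p : MvPolynomial (Fin 2) ℂ} {m : ℕ} (hp : p.IsHomogeneous m)
    (hm : 0 < m) : ∃ v : Fin 2 → ℂ, v ≠ 0 ∧ eval v p = 0 := by
  by_contra! hcon
  have haff (y : Fin 2 → Polynomial ℂ) (t : ℂ) :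
      (aeval y p).eval t = eval (fun i => (y i).eval t) p := by
    have h : (Polynomial.aeval t).comp (aeval y) = aeval fun i => (y i).eval t := by
      ext i
      simp [Polynomial.coe_aeval_eq_eval]
    rw [← aeval_eq_eval, ← h, AlgHom.comp_apply, Polynomial.coe_aeval_eq_eval]
  have hfun (a b t : Polynomial ℂ) (s : ℂ) :
      (fun i => ((![a, b] : Fin 2 → Polynomial ℂ) i).eval s) = ![a.eval s, b.eval s] := by
    funext i
    fin_cases i <;> rfl
  have hdeg : (aeval ![Polynomial.X, 1] p : Polynomial ℂ).degree = 0 := by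
    by_contra hne
    obtain ⟨t, ht⟩ := IsAlgClosed.exists_root _ hne
    rw [Polynomial.IsRoot, haff, hfun _ _ 0] at ht
    exact hcon _ (fun h => by simpa using congrFun h 1) ht
  obtain ⟨c, hc⟩ : ∃ c, (aeval ![Polynomial.X, 1] p : Polynomial ℂ) = Polynomial.C c :=
    ⟨_, Polynomial.eq_C_of_degree_eq_zero hdeg⟩
  have hq : (aeval ![1, Polynomial.X] p : Polynomial ℂ) = Polynomial.C c * Polynomial.X ^ m := by
    refine Polynomial.eq_of_infinite_eval_eq _ _
      ((Set.finite_singleton (0 : ℂ)).infinite_compl.mono fun s hs => ?_)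
    have hs : s ≠ 0 := hs
    have h1 : (![1, s] : Fin 2 → ℂ) = s • ![s⁻¹, 1] := by
      funext i
      fin_cases i <;> simp [hs]
    have h2 := haff ![Polynomial.X, 1] s⁻¹
    rw [hc, hfun _ _ 0] at h2
    simp only [Polynomial.eval_C, Polynomial.eval_X, Polynomial.eval_one] at h2
    change Polynomial.eval s _ = Polynomial.eval s _
    rw [haff, hfun _ _ 0]
    simp only [Polynomial.eval_X, Polynomial.eval_one, Polynomial.eval_mul, Polynomial.eval_C,
      Polynomial.eval_pow]
    rw [h1, eval_smul_of_isHomogeneous hp, ← h2, mul_comm]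
  have h3 := haff ![1, Polynomial.X] 0
  rw [hq, hfun _ _ 0] at h3
  simp only [Polynomial.eval_X, Polynomial.eval_one, Polynomial.eval_mul, Polynomial.eval_C,
    Polynomial.eval_pow, zero_pow hm.ne', mul_zero] at h3
  exact hcon _ (fun h => by simpa using congrFun h 0) h3.symm

theorem bind₁_lineForm_ne_zero {G : FormPair} {m : ℕ} (hG : ∀ i, (G i).IsHomogeneous m)
    (hm : 0 < m) (hG0 : NoCommonZero G) {u : Fin 2 → ℂ} (hu : u ≠ 0) :
    bind₁ G (lineForm u) ≠ 0 := by
  intro h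
  have hv (v : Fin 2 → ℂ) : u 1 * eval v (G 0) - u 0 * eval v (G 1) = 0 := by
    rw [bind₁_lineForm] at h
    simpa using congrArg (eval v) h
  obtain ⟨j, hj⟩ := Function.ne_iff.mp hu
  obtain ⟨v, hv0, hjv⟩ := exists_eval_eq_zero (hG j) hm
  have := hv v
  refine hG0 v hv0 (funext fun i => ?_)
  fin_cases j <;> simp only [Fin.mk_one, Fin.zero_eta, Pi.zero_apply] at hj hjv <;>
    rw [hjv] at this
  · have h1 : eval v (G 1) = 0 := by simpa [hj] using this
    fin_cases i <;> assumption
  · have h0 : eval v (G 0) = 0 := by simpa [hj] using this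
    fin_cases i <;> assumption

/-- If `p ∘ G = 0`, then `p` vanishes at the value `G (1, 0)`, so a line form splits off and the
degree drops. -/
theorem bind₁_ne_zero {G : FormPair} {m : ℕ} (hG : ∀ i, (G i).IsHomogeneous m)
    (hm : 0 < m) (hG0 : NoCommonZero G) {k : ℕ} :
    ∀ {p : MvPolynomial (Fin 2) ℂ}, p.IsHomogeneous k → p ≠ 0 → bind₁ G p ≠ 0 := by
  induction k with
  | zero =>
    intro p hp hp0 h
    have hpC := totalDegree_eq_zero_iff_eq_C.mp (Nat.le_zero.mp hp.totalDegree_le)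
    rw [hpC] at h hp0
    rw [bind₁_C_right] at h
    exact hp0 h
  | succ k ih =>
    intro p hp hp0 h
    have hu : evalPair G ![1, 0] ≠ 0 := hG0 _ fun h => by simpa using congrFun h 0
    have hpu : eval (evalPair G ![1, 0]) p = 0 := by rw [← eval_bind₁, h, map_zero]
    obtain ⟨q, hq, rfl⟩ := exists_isHomogeneous_eq_mul (a := 1) (b := k) (by rwa [add_comm])
      (lineForm_isHomogeneous _) (lineForm_ne_zero hu) ((lineForm_dvd_iff hu hp).mpr hpu)
    rw [map_mul] at h
    rcases mul_eq_zero.mp h with h | h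
    · exact bind₁_lineForm_ne_zero hG hm hG0 hu h
    · exact ih hq (right_ne_zero_of_mul hp0) h

theorem evalPair_eq_of_isHomogeneous_zero {G : FormPair} (hG : ∀ i, (G i).IsHomogeneous 0)
    (v w : Fin 2 → ℂ) : evalPair G v = evalPair G w := by
  funext i
  have hC := totalDegree_eq_zero_iff_eq_C.mp (Nat.le_zero.mp (hG i).totalDegree_le)
  rw [evalPair_apply, evalPair_apply, hC, eval_C, eval_C]

theorem toMap_eq {G : FormPair} (hG0 : NoCommonZero G) (z : P1) :
    toMap G z = Projectivization.mk ℂ (evalPair G z.rep) (hG0 _ z.rep_nonzero) := by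
  rw [toMap, dif_pos]
  rfl

theorem exists_smul_rep_mk {v : Fin 2 → ℂ} (hv : v ≠ 0) :
    ∃ c : ℂ, c ≠ 0 ∧ (Projectivization.mk ℂ v hv).rep = c • v := by
  obtain ⟨c, hc⟩ := Projectivization.exists_smul_eq_mk_rep ℂ v hv
  exact ⟨c, c.ne_zero, hc.symm⟩

/-- The role of the indeterminacy locus: for constant `φ` and `n ≥ 1` the form `H ∘ G^n` is the
value of `H` at the constant, which is zero only if that point is a hole. -/
theorem bind₁_iter_gcdForm_ne_zero {d : ℕ} {F : FormPair} (hF : ∀ i, (F i).IsHomogeneous d)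
    (hF0 : F ≠ 0) (hI : ¬ InIndeterminacyLocus F) (n : ℕ) :
    bind₁ (iter (reduced F) n) (gcdForm F) ≠ 0 := by
  obtain ⟨k, -, hH, hG⟩ := exists_degrees hF hF0
  have hG0 := noCommonZero_reduced hF hF0
  rcases Nat.eq_zero_or_pos (phiDeg F) with he | he
  · rw [he] at hG
    cases n with
    | zero =>
      intro h
      apply gcdForm_ne_zero hF0
      have := bind₁_X_left (σ := Fin 2) (R := ℂ)
      rw [iter, this] at h
      exact h
    | succ n =>
      intro h
      refine hI ⟨he, Projectivization.mk ℂ (evalPair (reduced F) ![1, 0])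
        (hG0 _ fun h => by simpa using congrFun h 0), ?_, fun z => ?_⟩
      · have h1 := congrArg (eval ![1, 0]) h
        rw [eval_bind₁, iter, evalPair_comp, evalPair_eq_of_isHomogeneous_zero hG _ ![1, 0],
          map_zero] at h1
        obtain ⟨c, -, hc⟩ := exists_smul_rep_mk (v := evalPair (reduced F) ![1, 0])
          (hG0 _ fun h => by simpa using congrFun h 0)
        rw [IsHole, hc, eval_smul_of_isHomogeneous hH, h1, mul_zero]
      · rw [phi, toMap_eq hG0]
        congr 1
        exact evalPair_eq_of_isHomogeneous_zero hG _ _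
  · exact bind₁_ne_zero (iter_isHomogeneous hG n) (pow_pos he n) (hG0.iter n) hH
      (gcdForm_ne_zero hF0)

/-! ### Depths of iterates -/

/-- The form `H_n` with `F^n = H_n * φ^n`, a multiple of the gcd of the `n`-th iterate. -/
noncomputable def holeForm (d : ℕ) (F : FormPair) : ℕ → MvPolynomial (Fin 2) ℂ
  | 0 => 1
  | n + 1 => holeForm d F n ^ d * bind₁ (iter (reduced F) n) (gcdForm F)

theorem iter_eq_holeForm_mul {d : ℕ} {F : FormPair} (hF : ∀ i, (F i).IsHomogeneous d) (n : ℕ) :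
    iter F n = fun i => holeForm d F n * iter (reduced F) n i := by
  induction n with
  | zero => simp [iter, holeForm]
  | succ n ih =>
    funext i
    rw [iter, comp, ih, bind₁_mul_of_isHomogeneous (hF i), eq_gcdForm_mul_reduced F i, map_mul,
      holeForm, mul_assoc]
    rfl

theorem finiteMultiplicity_pointForm (z : P1) {p : MvPolynomial (Fin 2) ℂ} (hp : p ≠ 0) :
    FiniteMultiplicity (pointForm z) p :=
  FiniteMultiplicity.of_prime_left (pointForm_prime z) hp

theorem holeForm_ne_zero {d : ℕ} {F : FormPair}
    (hH : ∀ n, bind₁ (iter (reduced F) n) (gcdForm F) ≠ 0) (n : ℕ) : holeForm d F n ≠ 0 := by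
  induction n with
  | zero => exact one_ne_zero
  | succ n ih => exact mul_ne_zero (pow_ne_zero _ ih) (hH n)

theorem multiplicity_holeForm_succ {d : ℕ} {F : FormPair}
    (hH : ∀ n, bind₁ (iter (reduced F) n) (gcdForm F) ≠ 0) (z : P1) (n : ℕ) :
    multiplicity (pointForm z) (holeForm d F (n + 1)) =
      d * multiplicity (pointForm z) (holeForm d F n) +
        multiplicity (pointForm z) (bind₁ (iter (reduced F) n) (gcdForm F)) := by
  have h := finiteMultiplicity_pointForm z (holeForm_ne_zero (d := d) hH (n + 1))
  rw [holeForm] at h ⊢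
  rw [multiplicity_mul (pointForm_prime z) h, FiniteMultiplicity.multiplicity_pow
    (pointForm_prime z) (finiteMultiplicity_pointForm z (holeForm_ne_zero hH n))]

/-- Some entry of `G^n` is nonzero at `z`, so the power of the prime `pointForm z` must divide
`H_n`. -/
theorem le_multiplicity_holeForm {d : ℕ} {F : FormPair} (hF : ∀ i, (F i).IsHomogeneous d)
    (hF0 : F ≠ 0) (hH : ∀ n, bind₁ (iter (reduced F) n) (gcdForm F) ≠ 0) {z : P1} {n N : ℕ}
    (h : ∀ i, pointForm z ^ N ∣ iter F n i) :
    N ≤ multiplicity (pointForm z) (holeForm d F n) := by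
  obtain ⟨-, -, -, hG⟩ := exists_degrees hF hF0
  have hnz := (noCommonZero_reduced hF hF0).iter n z.rep z.rep_nonzero
  obtain ⟨i, hi⟩ := Function.ne_iff.mp hnz
  have hi' : ¬ pointForm z ∣ iter (reduced F) n i := fun hd =>
    hi ((pointForm_dvd_iff z (iter_isHomogeneous hG n i)).mp hd)
  have hd := h i
  rw [iter_eq_holeForm_mul hF] at hd
  exact (finiteMultiplicity_pointForm z (holeForm_ne_zero hH n)).le_multiplicity_of_pow_dvd
    ((pointForm_prime z).pow_dvd_of_dvd_mul_right N hi' hd)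

theorem iter_ne_zero {d : ℕ} {F : FormPair} (hF : ∀ i, (F i).IsHomogeneous d)
    (hF0 : F ≠ 0) (hH : ∀ n, bind₁ (iter (reduced F) n) (gcdForm F) ≠ 0) (n : ℕ) :
    iter F n ≠ 0 := by
  intro h
  have hv : (![1, 0] : Fin 2 → ℂ) ≠ 0 := fun h => by simpa using congrFun h 0
  obtain ⟨i, hi⟩ := Function.ne_iff.mp ((noCommonZero_reduced hF hF0).iter n _ hv)
  have h1 := congrFun h i
  rw [iter_eq_holeForm_mul hF] at h1
  rcases mul_eq_zero.mp h1 with h2 | h2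
  · exact holeForm_ne_zero hH n h2
  · exact hi (by rw [evalPair_apply, h2, map_zero]; rfl)

/-- A destabilized pair of even degree `2 k` has a point of multiplicity at least `2 k² + k` in
its second iterate. -/
theorem IsDestabilized.exists_pow_dvd {k : ℕ} {Φ : FormPair}
    (hΦ : ∀ i, (Φ i).IsHomogeneous (k + k)) (h : IsDestabilized (k + k) Φ) :
    ∃ z : P1, ∀ i, pointForm z ^ (2 * (k * k) + k) ∣ comp Φ Φ i := by
  obtain ⟨A, h0, h1⟩ := h
  have hk : (k + k) / 2 = k := by omega
  rw [hk] at h0 h1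
  -- The zero of the second row of `A`, that is, the preimage under `A` of the point `(1 : 0)`.
  let w : Fin 2 → ℂ := ![-A 1 1, A 1 0]
  have hdet := SL2_det A
  have hw : w ≠ 0 := by
    intro hw
    have e0 : A 1 1 = 0 := by simpa [w] using congrFun hw 0
    have e1 : A 1 0 = 0 := by simpa [w] using congrFun hw 1
    rw [e0, e1] at hdet
    norm_num at hdet
  have hX : bind₁ (linearPair (A : Matrix (Fin 2) (Fin 2) ℂ)) (X 1) = lineForm w := by
    rw [bind₁_X_right, lineForm, linearPair, Fin.sum_univ_two]
    simp [w]
  have hpull (i : Fin 2) : bind₁ (linearPair (A : Matrix (Fin 2) (Fin 2) ℂ)) (conj A Φ i) =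
      C (A i 0) * Φ 0 + C (A i 1) * Φ 1 := by
    apply MvPolynomial.funext
    intro v
    have h2 := congrFun (evalPair_conj A Φ ((A : Matrix (Fin 2) (Fin 2) ℂ).mulVec v)) i
    rw [Matrix.mulVec_mulVec, ← Matrix.SpecialLinearGroup.coe_mul, inv_mul_cancel,
      Matrix.SpecialLinearGroup.coe_one, Matrix.one_mulVec] at h2
    rw [eval_bind₁, evalPair_linearPair]
    refine h2.trans ?_
    simp [Matrix.mulVec, dotProduct, evalPair]
  have h0' := map_dvd (bind₁ (linearPair (A : Matrix (Fin 2) (Fin 2) ℂ))) h0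
  have h1' := map_dvd (bind₁ (linearPair (A : Matrix (Fin 2) (Fin 2) ℂ))) h1
  rw [map_pow, hX, hpull] at h0' h1'
  have hline : bind₁ Φ (lineForm w) = C (A 1 0) * Φ 0 + C (A 1 1) * Φ 1 := by
    rw [bind₁_lineForm]
    simp [w]
  have hC : (C (A 0 0) * C (A 1 1) - C (A 0 1) * C (A 1 0) : MvPolynomial (Fin 2) ℂ) = 1 := by
    rw [← C_mul, ← C_mul, ← C_sub, hdet, C_1]
  have h1'' : lineForm w ^ k ∣ C (A 1 0) * Φ 0 + C (A 1 1) * Φ 1 :=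
    (pow_dvd_pow _ (Nat.le_succ k)).trans h1'
  have hdvd (i : Fin 2) : lineForm w ^ k ∣ Φ i := by
    fin_cases i
    · have e : Φ 0 = C (A 1 1) * (C (A 0 0) * Φ 0 + C (A 0 1) * Φ 1) -
          C (A 0 1) * (C (A 1 0) * Φ 0 + C (A 1 1) * Φ 1) := by
        linear_combination (-Φ 0) * hC
      change _ ∣ Φ 0
      rw [e]
      exact dvd_sub (h0'.mul_left _) (h1''.mul_left _)
    · have e : Φ 1 = C (A 0 0) * (C (A 1 0) * Φ 0 + C (A 1 1) * Φ 1) -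
          C (A 1 0) * (C (A 0 0) * Φ 0 + C (A 0 1) * Φ 1) := by
        linear_combination (-Φ 1) * hC
      change _ ∣ Φ 1
      rw [e]
      exact dvd_sub (h1''.mul_left _) (h0'.mul_left _)
  have hpowhom : (lineForm w ^ k).IsHomogeneous k := by
    simpa using (lineForm_isHomogeneous w).pow k
  choose R hR hΦR using fun i => exists_isHomogeneous_eq_mul (hΦ i) hpowhom
    (pow_ne_zero k (lineForm_ne_zero hw)) (hdvd i)
  have hΦR' : Φ = fun i => lineForm w ^ k * R i := funext hΦR
  obtain ⟨c, hc, hrep⟩ := exists_smul_rep_mk hw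
  refine ⟨Projectivization.mk ℂ w hw, fun i => ?_⟩
  have hassoc : Associated (lineForm w) (pointForm (Projectivization.mk ℂ w hw)) := by
    rw [pointForm_eq, hrep, lineForm_smul]
    exact ⟨((Ne.isUnit hc).map C).unit, mul_comm _ _⟩
  rw [← (hassoc.pow_pow (n := 2 * (k * k) + k)).dvd_iff_dvd_left]
  have hcomp : comp Φ Φ i = bind₁ Φ (lineForm w) ^ k * bind₁ Φ (R i) := by
    rw [comp]
    conv_lhs => rw [hΦR i]
    rw [map_mul, map_pow]
  have hRi : bind₁ Φ (R i) = (lineForm w ^ k) ^ k * bind₁ R (R i) := by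
    conv_lhs => rw [hΦR']
    exact bind₁_mul_of_isHomogeneous (hR i) _ _
  -- With `ℓ = lineForm w` and `Φ = ℓ^k R`, the composition is `(ℓ ∘ Φ)^k * (R_i ∘ Φ)`. Here `ℓ ∘ Φ`
  -- is divisible by `ℓ^(k+1)` and `R_i ∘ Φ = ℓ^(k²) (R_i ∘ R)`.
  have hexp : lineForm w ^ (2 * (k * k) + k) =
      (lineForm w ^ (k + 1)) ^ k * (lineForm w ^ k) ^ k := by
    rw [← pow_mul, ← pow_mul, ← pow_add]
    congr 1
    ring
  rw [hcomp, hRi, hexp, hline]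
  exact mul_dvd_mul (pow_dvd_pow_of_dvd h1' k) (Dvd.intro _ rfl)

/-- All iterates are stable if and only if their depths are at most half of their degrees. -/
theorem forall_isGITStable_iter_iff {d : ℕ} (hd : Even d) (hd2 : 2 ≤ d) {F : FormPair}
    (hF : ∀ i, (F i).IsHomogeneous d) (hF0 : F ≠ 0)
    (hH : ∀ n, bind₁ (iter (reduced F) n) (gcdForm F) ≠ 0) :
    (∀ n : ℕ, 1 ≤ n → IsGITStable (d ^ n) (iter F n)) ↔
      ∀ (z : P1) (n : ℕ), 2 * multiplicity (pointForm z) (holeForm d F n) ≤ d ^ n := by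
  constructor
  · intro h z n
    rcases Nat.eq_zero_or_pos n with rfl | hn
    · rw [holeForm, multiplicity_of_one_right (pointForm_prime z).not_isUnit]
      simp
    · refine (h n hn).two_mul_le (hd.pow_of_ne_zero (Nat.one_le_iff_ne_zero.mp hn))
        (iter_isHomogeneous hF n) z.rep_nonzero fun i => ?_
      rw [iter_eq_holeForm_mul hF]
      exact (pow_multiplicity_dvd _ _).mul_right _
  · intro h n hn
    refine isGITStable_of_not_isDestabilized (hd.pow_of_ne_zero (Nat.one_le_iff_ne_zero.mp hn))
      (iter_isHomogeneous hF n) (iter_ne_zero hF hF0 hH n) fun hdes => ?_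
    obtain ⟨k, hk⟩ : Even (d ^ n) := hd.pow_of_ne_zero (Nat.one_le_iff_ne_zero.mp hn)
    have hpos : 0 < d ^ n := pow_pos (by omega) n
    obtain ⟨z, hz⟩ := IsDestabilized.exists_pow_dvd (k := k) (Φ := iter F n)
      (by rw [← hk]; exact iter_isHomogeneous hF n) (by rwa [← hk])
    rw [← iter_add] at hz
    -- The depth of `F^{2n}` at `z` is at least `2 k² + k`, but half of its degree `(2 k)²` is `2
    -- k²`.
    have h1 := le_multiplicity_holeForm hF hF0 hH hz
    have h2 := h z (n + n)
    rw [pow_add, hk] at h2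
    nlinarith

/-! ### Points of the projective line -/

instance instBorelSpaceP1 : BorelSpace P1 := ⟨rfl⟩

theorem mk_eq_iff_eval_pointForm {v : Fin 2 → ℂ} (hv : v ≠ 0) (z : P1) :
    Projectivization.mk ℂ v hv = z ↔ eval v (pointForm z) = 0 := by
  rw [pointForm_eq, eval_lineForm_eq_zero_iff z.rep_nonzero]
  conv_lhs => rw [← z.mk_rep]
  rw [Projectivization.mk_eq_mk_iff']
  simp only [eq_comm]

theorem isClosed_singleton_P1 (z : P1) : IsClosed ({z} : Set P1) := by
  refine isClosed_coinduced.mpr ?_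
  have h : Projectivization.mk' ℂ ⁻¹' ({z} : Set P1) =
      {v : {v : Fin 2 → ℂ // v ≠ 0} | z.rep 1 * v.1 0 - z.rep 0 * v.1 1 = 0} := by
    ext v
    refine (mk_eq_iff_eval_pointForm v.2 z).trans ?_
    rw [pointForm_eq, eval_lineForm]
    rfl
  rw [h]
  have hc (i : Fin 2) : Continuous fun v : {v : Fin 2 → ℂ // v ≠ 0} => v.1 i :=
    (continuous_apply i).comp continuous_subtype_val
  exact isClosed_eq ((continuous_const.mul (hc 0)).sub (continuous_const.mul (hc 1)))
    continuous_const

theorem measurableSet_singleton_P1 (z : P1) : MeasurableSet ({z} : Set P1) :=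
  (isClosed_singleton_P1 z).measurableSet

theorem sum_smul_dirac_singleton (c : P1 → ℝ≥0∞) (z : P1) :
    (Measure.sum fun x : P1 => c x • Measure.dirac x) {z} = c z := by
  rw [Measure.sum_apply _ (measurableSet_singleton_P1 z), tsum_eq_single z]
  · simp
  · intro x hx
    rw [Measure.smul_apply, Measure.dirac_apply' _ (measurableSet_singleton_P1 z)]
    simp [hx]

/-! ### Multiplicities of solutions -/

theorem solMult_eq (G : FormPair) (z h : P1) :
    solMult G z h = multiplicity (pointForm z) (bind₁ G (pointForm h)) := by
  rw [solMult, pointForm_eq h, bind₁_lineForm]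

theorem bind₁_pointForm_isHomogeneous {G : FormPair} {m : ℕ} (hG : ∀ i, (G i).IsHomogeneous m)
    (h : P1) : (bind₁ G (pointForm h)).IsHomogeneous m := by
  have := bind₁_isHomogeneous (lineForm_isHomogeneous h.rep) hG
  rwa [mul_one] at this

theorem toMap_eq_iff {G : FormPair} (hG0 : NoCommonZero G) (z h : P1) :
    toMap G z = h ↔ eval z.rep (bind₁ G (pointForm h)) = 0 := by
  rw [toMap_eq hG0, mk_eq_iff_eval_pointForm, eval_bind₁]

theorem solMult_eq_zero {G : FormPair} {m : ℕ} (hG : ∀ i, (G i).IsHomogeneous m)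
    (hG0 : NoCommonZero G) {z h : P1} (hne : toMap G z ≠ h) : solMult G z h = 0 := by
  rw [solMult_eq, multiplicity_eq_zero,
    pointForm_dvd_iff z (bind₁_pointForm_isHomogeneous hG h), ← toMap_eq_iff hG0]
  exact hne

/-- The order of vanishing of a pull-back. -/
theorem multiplicity_bind₁ {G : FormPair} {m : ℕ} (hG : ∀ i, (G i).IsHomogeneous m)
    (hm : 0 < m) (hG0 : NoCommonZero G) {p : MvPolynomial (Fin 2) ℂ} {k : ℕ}
    (hp : p.IsHomogeneous k) (hp0 : p ≠ 0) (z : P1) :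
    multiplicity (pointForm z) (bind₁ G p) =
      multiplicity (pointForm (toMap G z)) p * solMult G z (toMap G z) := by
  set h := toMap G z with hh
  obtain ⟨q, hpq, hq⟩ :=
    (finiteMultiplicity_pointForm h hp0).exists_eq_pow_mul_and_not_dvd
  set a := multiplicity (pointForm h) p
  have hne := bind₁_ne_zero hG hm hG0 hp hp0
  have hq0 : q ≠ 0 := fun h0 => hp0 (by rw [hpq, h0, mul_zero])
  obtain ⟨e, he⟩ := exists_isHomogeneous_of_mul (p := q) (q := pointForm h ^ a)
    (by rwa [mul_comm, ← hpq]) (by rwa [mul_comm, ← hpq])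
  have hL : bind₁ G (pointForm h) ≠ 0 := bind₁_lineForm_ne_zero hG hm hG0 h.rep_nonzero
  -- The cofactor `q` is nonzero at `h = G z`, so its pull-back is nonzero at `z`.
  have hqz : multiplicity (pointForm z) (bind₁ G q) = 0 := by
    rw [multiplicity_eq_zero, pointForm_dvd_iff z (bind₁_isHomogeneous he hG), eval_bind₁]
    rw [pointForm_dvd_iff h he] at hq
    obtain ⟨c, hc, hrep⟩ := exists_smul_rep_mk (hG0 z.rep z.rep_nonzero)
    rw [← toMap_eq hG0, ← hh] at hrep
    rw [hrep, eval_smul_of_isHomogeneous he] at hq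
    exact right_ne_zero_of_mul hq
  rw [hpq, map_mul, map_pow] at hne ⊢
  rw [multiplicity_mul (pointForm_prime z) (finiteMultiplicity_pointForm z hne), hqz,
    FiniteMultiplicity.multiplicity_pow (pointForm_prime z) (finiteMultiplicity_pointForm z hL),
    add_zero, ← solMult_eq]

/-! ### Masses of points for the atomic measures -/

/-- For each `n` only the hole candidate `h = φ^n z` contributes, and its depth times the local
degree is the order of `H ∘ G^n` at `z`. -/
theorem atomicMeasure_singleton {d : ℕ} {F : FormPair} (hF : ∀ i, (F i).IsHomogeneous d)
    (hF0 : F ≠ 0) (he : 0 < phiDeg F) (z : P1) :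
    atomicMeasure d F {z} = ∑' n : ℕ, ((d : ℝ≥0∞) ^ (n + 1))⁻¹ *
      (multiplicity (pointForm z) (bind₁ (iter (reduced F) n) (gcdForm F)) : ℝ≥0∞) := by
  obtain ⟨k, -, hH, hG⟩ := exists_degrees hF hF0
  have hG0 := noCommonZero_reduced hF hF0
  rw [atomicMeasure, Measure.sum_apply _ (measurableSet_singleton_P1 z)]
  refine tsum_congr fun n => ?_
  rw [Measure.sum_apply _ (measurableSet_singleton_P1 z),
    tsum_eq_single (toMap (iter (reduced F) n) z)]
  · rw [sum_smul_dirac_singleton, multiplicity_bind₁ (iter_isHomogeneous hG n) (pow_pos he n)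
      (hG0.iter n) hH (gcdForm_ne_zero hF0), depth, mul_assoc]
    push_cast
    rfl
  · intro h hh
    rw [sum_smul_dirac_singleton, solMult_eq_zero (iter_isHomogeneous hG n) (hG0.iter n) hh.symm]
    simp

theorem multiplicity_eq_zero_of_isHomogeneous_zero {p : MvPolynomial (Fin 2) ℂ}
    (hp : p.IsHomogeneous 0) (hp0 : p ≠ 0) (z : P1) : multiplicity (pointForm z) p = 0 := by
  have hC := totalDegree_eq_zero_iff_eq_C.mp (Nat.le_zero.mp hp.totalDegree_le)
  rw [multiplicity_eq_zero, pointForm_dvd_iff z hp, hC, eval_C]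
  intro h
  rw [h, C_0] at hC
  exact hp0 hC

/-- For constant `φ` the terms with `n ≥ 1` vanish, as `H ∘ G^n` is a nonzero constant; so the same
series serves both degenerate cases. -/
theorem holeMeasure_singleton {d : ℕ} {F : FormPair} (hF : ∀ i, (F i).IsHomogeneous d)
    (hF0 : F ≠ 0) (he : phiDeg F = 0)
    (hH : ∀ n, bind₁ (iter (reduced F) n) (gcdForm F) ≠ 0) (z : P1) :
    holeMeasure d F {z} = ∑' n : ℕ, ((d : ℝ≥0∞) ^ (n + 1))⁻¹ *
      (multiplicity (pointForm z) (bind₁ (iter (reduced F) n) (gcdForm F)) : ℝ≥0∞) := by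
  obtain ⟨k, -, hHk, hG⟩ := exists_degrees hF hF0
  rw [he] at hG
  rw [holeMeasure, sum_smul_dirac_singleton, tsum_eq_single 0]
  · have : bind₁ (iter (reduced F) 0) (gcdForm F) = gcdForm F := by
      rw [iter, bind₁_X_left]
      rfl
    rw [this, depth, zero_add, pow_one]
  · intro n hn
    have hhom := bind₁_isHomogeneous hHk (iter_isHomogeneous hG n)
    rw [zero_pow hn, zero_mul] at hhom
    rw [multiplicity_eq_zero_of_isHomogeneous_zero hhom (hH n)]
    simp

theorem sum_range_eq_multiplicity_div {d : ℕ} (hd : d ≠ 0) {F : FormPair}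
    (hH : ∀ n, bind₁ (iter (reduced F) n) (gcdForm F) ≠ 0) (z : P1) (n : ℕ) :
    ∑ j ∈ Finset.range n, ((d : ℝ≥0∞) ^ (j + 1))⁻¹ *
      (multiplicity (pointForm z) (bind₁ (iter (reduced F) j) (gcdForm F)) : ℝ≥0∞) =
    (multiplicity (pointForm z) (holeForm d F n) : ℝ≥0∞) / (d : ℝ≥0∞) ^ n := by
  have hd0 : (d : ℝ≥0∞) ≠ 0 := by exact_mod_cast hd
  have hdt : (d : ℝ≥0∞) ≠ ⊤ := ENNReal.natCast_ne_top d
  induction n with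
  | zero =>
    rw [holeForm, multiplicity_of_one_right (pointForm_prime z).not_isUnit]
    simp
  | succ n ih =>
    rw [Finset.sum_range_succ, ih, multiplicity_holeForm_succ hH]
    push_cast
    rw [ENNReal.add_div, pow_succ' (d : ℝ≥0∞) n, ENNReal.mul_div_mul_left _ _ hd0 hdt]
    congr 1
    rw [mul_comm, div_eq_mul_inv]

/-- A series in `ℝ≥0∞` is the supremum of its partial sums, so the bound on the sum is the bound on
every normalized depth. -/
theorem tsum_le_half_iff {d : ℕ} (hd : d ≠ 0) {F : FormPair}
    (hH : ∀ n, bind₁ (iter (reduced F) n) (gcdForm F) ≠ 0) (z : P1) :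
    ∑' n : ℕ, ((d : ℝ≥0∞) ^ (n + 1))⁻¹ *
      (multiplicity (pointForm z) (bind₁ (iter (reduced F) n) (gcdForm F)) : ℝ≥0∞) ≤ 1 / 2 ↔
    ∀ n : ℕ, 2 * multiplicity (pointForm z) (holeForm d F n) ≤ d ^ n := by
  rw [ENNReal.tsum_eq_iSup_nat, iSup_le_iff]
  refine forall_congr' fun n => ?_
  have h0 : (d : ℝ≥0∞) ^ n ≠ 0 := pow_ne_zero _ (by exact_mod_cast hd)
  have ht : (d : ℝ≥0∞) ^ n ≠ ⊤ := ENNReal.pow_ne_top (ENNReal.natCast_ne_top d)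
  rw [sum_range_eq_multiplicity_div hd hH, ENNReal.div_le_iff h0 ht, one_div, mul_comm 2⁻¹,
    ← div_eq_mul_inv, ENNReal.le_div_iff_mul_le (by simp) (by simp), mul_comm]
  exact_mod_cast Iff.rfl

/-! ### The measure of maximal entropy has no atoms -/

section MaximalMeasure

variable {d : ℕ} {G : FormPair}

theorem solMult_le (hG : ∀ i, (G i).IsHomogeneous d) (hd : 0 < d) (hG0 : NoCommonZero G)
    (z h : P1) : solMult G z h ≤ d := by
  have hne := bind₁_lineForm_ne_zero hG hd hG0 h.rep_nonzero
  rw [solMult_eq]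
  obtain ⟨r, hr⟩ := pow_multiplicity_dvd (pointForm z) (bind₁ G (pointForm h))
  rw [← pointForm_eq, hr] at hne
  have hpow := (lineForm_isHomogeneous z.rep).pow
    (multiplicity (pointForm z) (bind₁ G (pointForm h)))
  rw [← pointForm_eq, one_mul] at hpow
  have h1 := (bind₁_pointForm_isHomogeneous hG h).totalDegree_le
  rw [hr, totalDegree_mul_of_isDomain (left_ne_zero_of_mul hne) (right_ne_zero_of_mul hne),
    hpow.totalDegree (left_ne_zero_of_mul hne)] at h1
  omega

/-- A totally ramified point is the only point of its fibre. -/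
theorem eq_of_solMult_eq (hG : ∀ i, (G i).IsHomogeneous d) (hd : 0 < d) (hG0 : NoCommonZero G)
    {z z' h : P1} (hz : solMult G z h = d) (hz' : toMap G z' = h) : z' = z := by
  have hne := bind₁_lineForm_ne_zero hG hd hG0 h.rep_nonzero
  rw [← pointForm_eq] at hne
  have hdvd := pow_multiplicity_dvd (pointForm z) (bind₁ G (pointForm h))
  rw [← solMult_eq, hz] at hdvd
  have hpow := (lineForm_isHomogeneous z.rep).pow d
  rw [← pointForm_eq, one_mul] at hpow
  obtain ⟨r, hr, hmul⟩ := exists_isHomogeneous_eq_mul (a := d) (b := 0)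
    (bind₁_pointForm_isHomogeneous hG h) hpow (pow_ne_zero _ (pointForm_prime z).ne_zero) hdvd
  rw [hmul] at hne
  have hev := (toMap_eq_iff hG0 z' h).mp hz'
  rw [hmul, map_mul, map_pow] at hev
  have hC := totalDegree_eq_zero_iff_eq_C.mp (Nat.le_zero.mp hr.totalDegree_le)
  rcases mul_eq_zero.mp hev with h1 | h1
  · rw [← (mk_eq_iff_eval_pointForm z'.rep_nonzero z).mpr (pow_eq_zero_iff hd.ne' |>.mp h1),
      Projectivization.mk_rep]
  · rw [hC, eval_C] at h1
    rw [h1, C_0] at hC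
    exact absurd hC (right_ne_zero_of_mul hne)

theorem solMult_mul_measure {F : FormPair} (hG : ∀ i, (reduced F i).IsHomogeneous d)
    (hG0 : NoCommonZero (reduced F)) {μ : Measure P1} (hμ : IsMaximalMeasure d F μ) (z : P1) :
    (solMult (reduced F) z (phi F z) : ℝ≥0∞) * μ {phi F z} = (d : ℝ≥0∞) * μ {z} := by
  rw [← hμ.pullback {z} (measurableSet_singleton_P1 z)]
  have h (x : P1) : (∑' z' : ({z} : Set P1), (solMult (reduced F) z' x : ℝ≥0∞)) =
      Set.indicator {phi F z} (fun _ => (solMult (reduced F) z (phi F z) : ℝ≥0∞)) x := by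
    rw [tsum_singleton z fun z' : P1 => (solMult (reduced F) z' x : ℝ≥0∞)]
    by_cases hx : x = phi F z
    · rw [hx, Set.indicator_of_mem (Set.mem_singleton _)]
    · rw [Set.indicator_of_notMem (Set.notMem_singleton_iff.mpr hx),
        solMult_eq_zero hG hG0 (Ne.symm hx), Nat.cast_zero]
  simp only [h]
  rw [lintegral_indicator_const (measurableSet_singleton_P1 _)]

/-- Local degrees are at most `d`, so masses do not decrease along orbits. The orbit of an atom is
then finite and ends in a cycle of constant mass. This forces total ramification along the cycle, so
its points are exceptional and have mass zero. -/
theorem IsMaximalMeasure.measure_singleton {F : FormPair} (hd : 0 < d)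
    (hG : ∀ i, (reduced F i).IsHomogeneous d) (hG0 : NoCommonZero (reduced F))
    {μ : Measure P1} (hμ : IsMaximalMeasure d F μ) (z : P1) : μ {z} = 0 := by
  have := hμ.isProbabilityMeasure
  have hd0 : (d : ℝ≥0∞) ≠ 0 := by exact_mod_cast hd.ne'
  have hdt : (d : ℝ≥0∞) ≠ ⊤ := ENNReal.natCast_ne_top d
  have hstep (x : P1) : μ {x} ≤ μ {phi F x} := by
    rw [← ENNReal.mul_le_mul_iff_right hd0 hdt, ← solMult_mul_measure hG hG0 hμ]
    gcongr
    exact solMult_le hG hd hG0 _ _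
  have hmono (x : P1) : Monotone fun n => μ {(phi F)^[n] x} :=
    monotone_nat_of_le_succ fun n => by
      rw [Function.iterate_succ_apply']
      exact hstep _
  by_contra hz
  have hninj : ¬ Function.Injective fun n => (phi F)^[n] z := by
    intro hinj
    have hfin := Measure.finite_const_le_meas_of_disjoint_iUnion μ (pos_iff_ne_zero.mpr hz)
      (As := fun n : ℕ => ({(phi F)^[n] z} : Set P1)) (fun n => measurableSet_singleton_P1 _)
      (fun m n hmn => Set.disjoint_singleton.mpr (hinj.ne hmn)) (measure_ne_top μ _)
    refine Set.infinite_univ (hfin.subset fun n _ => ?_)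
    exact hmono z (Nat.zero_le n)
  obtain ⟨i, j, hij, hlt⟩ : ∃ i j, (phi F)^[i] z = (phi F)^[j] z ∧ i < j := by
    simp only [Function.Injective, not_forall] at hninj
    obtain ⟨a, b, hab, hne⟩ := hninj
    rcases lt_or_gt_of_ne hne with h | h
    · exact ⟨a, b, hab, h⟩
    · exact ⟨b, a, hab.symm, h⟩
  set y := (phi F)^[i] z with hy
  have hper : Function.IsPeriodicPt (phi F) (j - i) y := by
    rw [Function.IsPeriodicPt, Function.IsFixedPt]
    rw [hy, ← Function.iterate_add_apply, Nat.sub_add_cancel hlt.le, ← hij]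
  have hp : 0 < j - i := by omega
  have hy0 : μ {y} ≠ 0 := fun h0 => hz (le_antisymm ((hmono z (Nat.zero_le i)).trans h0.le) bot_le)
  have hconst (n : ℕ) : μ {(phi F)^[n] y} = μ {y} := by
    refine le_antisymm ?_ (hmono y (Nat.zero_le n))
    have h1 := hmono y (Nat.le_mul_of_pos_right n hp)
    have h2 : (phi F)^[n * (j - i)] y = y := (hper.const_mul n).eq
    simpa only [h2] using h1
  have hram (n : ℕ) : solMult (reduced F) ((phi F)^[n] y) ((phi F)^[n + 1] y) = d := by
    have h := solMult_mul_measure hG hG0 hμ ((phi F)^[n] y)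
    rw [← Function.iterate_succ_apply' (phi F) n y, hconst, hconst,
      ENNReal.mul_left_inj hy0 (measure_ne_top μ _)] at h
    exact_mod_cast h
  -- The fibre over a point of the cycle is the single totally ramified point preceding it in the
  -- cycle; `j - i - 1` further steps reach that predecessor.
  have hback (w : P1) : phi F w ∈ Set.range (fun n => (phi F)^[n] y) →
      w ∈ Set.range fun n => (phi F)^[n] y := by
    rintro ⟨n, hn⟩
    refine ⟨n + (j - i - 1), ?_⟩
    have h1 : (phi F)^[n + (j - i - 1) + 1] y = phi F w := by
      rw [← hn, show n + (j - i - 1) + 1 = n + (j - i) by omega, Function.iterate_add_apply,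
        hper.eq]
    exact (eq_of_solMult_eq hG hd hG0 (hram _) h1.symm).symm
  refine hy0 (hμ.nonexceptional y ?_)
  refine Set.Finite.subset ((Set.finite_Iio (j - i)).image fun n => (phi F)^[n] y) ?_
  have hmem (n : ℕ) (w : P1) (hn : (phi F)^[n] w = y) : w ∈ Set.range fun n => (phi F)^[n] y := by
    induction n generalizing w with
    | zero => exact ⟨0, hn.symm⟩
    | succ n ih =>
      rw [Function.iterate_succ_apply] at hn
      exact hback w (ih (phi F w) hn)
  rintro w ⟨n, hn⟩
  obtain ⟨m, rfl⟩ := hmem n w hn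
  exact ⟨m % (j - i), Nat.mod_lt _ hp, hper.iterate_mod_apply m⟩

end MaximalMeasure

end RatBar

theorem mainTheorem11 (d : ℕ) (hd : Even d) (hd2 : 2 ≤ d) (F : RatBar.FormPair)
    (hF : ∀ i, (F i).IsHomogeneous d) (hF0 : F ≠ 0)
    (hI : ¬ RatBar.InIndeterminacyLocus F)
    (μ : MeasureTheory.Measure RatBar.P1) (hμ : RatBar.IsMeasureOf d F μ) :
    (∀ n : ℕ, 1 ≤ n → RatBar.IsGITStable (d ^ n) (RatBar.iter F n)) ↔
      ∀ z : RatBar.P1, μ {z} ≤ 1 / 2 := by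
  have hH := RatBar.bind₁_iter_gcdForm_ne_zero hF hF0 hI
  have hd0 : d ≠ 0 := by omega
  rw [RatBar.forall_isGITStable_iter_iff hd hd2 hF hF0 hH]
  refine forall_congr' fun z => ?_
  rw [← RatBar.tsum_le_half_iff hd0 hH z]
  rw [RatBar.IsMeasureOf] at hμ
  split_ifs at hμ with h1 h2
  -- For `deg φ = d` the gcd is constant, so every depth is `0`, and both conditions hold.
  · obtain ⟨k, hk, hHk, hG⟩ := RatBar.exists_degrees hF hF0
    rw [h1] at hk hG
    rw [show k = 0 by omega] at hHk
    rw [hμ.measure_singleton (by omega) hG (RatBar.noCommonZero_reduced hF hF0)]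
    refine iff_of_true ?_ bot_le
    rw [ENNReal.tsum_eq_zero.mpr]
    · exact bot_le
    · intro n
      have hhom := RatBar.bind₁_isHomogeneous hHk (RatBar.iter_isHomogeneous hG n)
      rw [mul_zero] at hhom
      rw [RatBar.multiplicity_eq_zero_of_isHomogeneous_zero hhom (hH n), Nat.cast_zero, mul_zero]
  · rw [hμ, RatBar.atomicMeasure_singleton hF hF0 h2]
  · rw [hμ, RatBar.holeMeasure_singleton hF hF0 (by omega) hH]
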